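/- Let $d\ge 0$ and $n\ge 0$ be integers, and let $a,b:\mathbb R^{2d}\to\mathbb R$ be Schwartz functions. For $\varepsilon>0$ and a Schwartz function $c:\mathbb R^{2d}\to\mathbb C$ let ${\rm op}^{\rm We}(c)$ be the Weyl quantization, the bounded operator on $L^2(\mathbb R^d)$ given by $$({\rm op}^{\rm We}(c)\psi)(q)=(2\pi\varepsilon)^{-d}\int_{\mathbb R^d}\int_{\mathbb R^d} c\big(\tfrac{q+y}{2},p\big)\,e^{i(q-y)\cdot p/\varepsilon}\,\psi(y)\,dp\,dy ,$$ and let ${\rm op}^{\rm AW}(c)={\rm op}^{\rm We}(c*G_{\varepsilon/2})$ be the Anti-Wick quantization, where $G_{\varepsilon/2}(z)=(\pi\varepsilon)^{-d}e^{-|z|^2/\varepsilon}$ for $z\in\mathbb R^{2d}$. Then there is a family of Schwartz functions $\gamma_n^\varepsilon=\gamma_n^\varepsilon(a,b):\mathbb R^{2d}\to\mathbb C$, $\varepsilon>0$, with $$\sup_{\varepsilon>0}\big\|{\rm op}^{\rm We}(\gamma_n^\varepsilon)\big\|_{\mathcal L(L^2(\mathbb R^d))}<\infty ,$$ such that for all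 $\varepsilon>0$ $${\rm op}^{\rm AW}(a)\,{\rm op}^{\rm AW}(b)={\rm op}^{\rm AW}\Big(ab+\sum_{m=1}^{n}\varepsilon^m\lambda_m(a,b)\Big)+\varepsilon^{n+1}\,{\rm op}^{\rm We}(\gamma_n^\varepsilon),$$ where $$\lambda_m(a,b)(z)=\frac{(-1)^m}{2^m m!}\Big[\big((\nabla_z,\nabla_w)+i\,(J\nabla_z,\nabla_w)\big)^m\big(a(z)\,b(w)\big)\Big]_{w=z},\qquad J=\begin{pmatrix}0&{\rm Id}\\-{\rm Id}&0\end{pmatrix}.$$ Here, with $z=(q,p)$ and $w=(q',p')$, $(\nabla_z,\nabla_w)=\sum_{j=1}^d(\partial_{q_j}\partial_{q'_j}+\partial_{p_j}\partial_{p'_j})$ and $(J\nabla_z,\nabla_w)=\sum_{j=1}^d(\partial_{p_j}\partial_{q'_j}-\partial_{q_j}\partial_{p'_j})$. -/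

import Mathlib

open scoped SchwartzMap LineDeriv
open MeasureTheory

noncomputable section

namespace AntiWick

/-- Configuration space `ℝ^d` with the Euclidean norm. -/
abbrev Config (d : ℕ) : Type := EuclideanSpace ℝ (Fin d)

/-- Phase space `ℝ^{2d}` with its Euclidean norm; its points are `z = (q, p)`. -/
abbrev Phase (d : ℕ) : Type := WithLp 2 (Config d × Config d)

/-- The point `(q, p)` of phase space. -/
abbrev pt {d : ℕ} (q p : Config d) : Phase d := WithLp.toLp 2 (q, p)

/-- The Hilbert space `L²(ℝ^d)` of complex-valued square integrable functions. -/
abbrev L2 (d : ℕ) : Type := Lp ℂ 2 (volume : Measure (Config d))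

/-- A real-valued Schwartz function, regarded as a complex-valued one. -/
def toComplex {d : ℕ} (a : 𝓢(Phase d, ℝ)) : 𝓢(Phase d, ℂ) :=
  SchwartzMap.postcompCLM (𝕜 := ℝ) Complex.ofRealCLM a

theorem toComplex_apply {d : ℕ} (a : 𝓢(Phase d, ℝ)) (z : Phase d) :
    toComplex a z = (a z : ℂ) := rfl

/-- The pointwise product `a b` of two Schwartz functions. -/
def mulS {d : ℕ} (a b : 𝓢(Phase d, ℂ)) : 𝓢(Phase d, ℂ) :=
  SchwartzMap.pairing (ContinuousLinearMap.mul ℂ ℂ) a b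

theorem mulS_apply {d : ℕ} (a b : 𝓢(Phase d, ℂ)) (z : Phase d) :
    mulS a b z = a z * b z := rfl

/-! ### Weyl quantization -/

/-- `(op^We(a) ψ)(q) = (2πε)^{-d} ∫∫ a((q+y)/2, p) e^{i (q-y)·p/ε} ψ(y) dp dy`. -/
def weylFun {d : ℕ} (ε : ℝ) (a : 𝓢(Phase d, ℂ)) (ψ : Config d → ℂ) (q : Config d) : ℂ :=
  (((2 * Real.pi * ε) ^ d)⁻¹ : ℝ) * ∫ y : Config d, ∫ p : Config d,
    a (pt ((2 : ℝ)⁻¹ • (q + y)) p) *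
      Complex.exp (Complex.I * ((inner ℝ (q - y) p / ε : ℝ) : ℂ)) * ψ y

/-- The integral kernel of `weylFun`, without the factor `(2πε)^{-d}`. -/
def weylKer {d : ℕ} (ε : ℝ) (a : 𝓢(Phase d, ℂ)) (q y : Config d) : ℂ :=
  ∫ p : Config d, a (pt ((2 : ℝ)⁻¹ • (q + y)) p) *
      Complex.exp (Complex.I * ((inner ℝ (q - y) p / ε : ℝ) : ℂ))

theorem weylFun_eq {d : ℕ} (ε : ℝ) (a : 𝓢(Phase d, ℂ)) (ψ : Config d → ℂ) (q : Config d) :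
    weylFun ε a ψ q =
      (((2 * Real.pi * ε) ^ d)⁻¹ : ℝ) * ∫ y : Config d, weylKer ε a q y * ψ y := by
  simp only [weylFun, weylKer, integral_mul_const]

/-- The symbol restricted to fixed position `x` is smooth in the momentum `p`. -/
theorem slice_contDiff {d : ℕ} (a : 𝓢(Phase d, ℂ)) (x : Config d) :
    ContDiff ℝ (⊤ : ℕ∞) (fun p => a (pt x p)) :=
  (a.smooth ⊤).comp <|
    (WithLp.prodContinuousLinearEquiv 2 ℝ (Config d) (Config d)).symm.contDiff.comp
      (contDiff_const.prodMk contDiff_id)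

theorem slice_bound {d : ℕ} (a : 𝓢(Phase d, ℂ)) (m k n : ℕ) :
    ∃ C, ∀ x p : Config d,
      ‖x‖ ^ m * (‖p‖ ^ k * ‖iteratedFDeriv ℝ n (fun p => a (pt x p)) p‖) ≤ C := by
  let L : Config d →L[ℝ] Phase d :=
    (WithLp.prodContinuousLinearEquiv 2 ℝ (Config d) (Config d)).symm.toContinuousLinearMap ∘L
      ContinuousLinearMap.inr ℝ (Config d) (Config d)
  obtain ⟨C, -, hC⟩ := a.decay (m + k) n
  refine ⟨C * ‖L‖ ^ n, fun x p => ?_⟩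
  have h1 : (fun p => a (pt x p)) = (fun z => a (z + pt x 0)) ∘ L := by
    funext p
    simp only [Function.comp, L]
    congr 1
    refine WithLp.ofLp_injective 2 ?_
    simp
  have hx : ‖x‖ ≤ ‖pt x p‖ := by
    rw [WithLp.prod_norm_eq_of_L2]
    exact Real.le_sqrt_of_sq_le (by simp)
  have hp : ‖p‖ ≤ ‖pt x p‖ := by
    rw [WithLp.prod_norm_eq_of_L2]
    exact Real.le_sqrt_of_sq_le (by simp)
  have hz : L p + pt x 0 = pt x p := by
    refine WithLp.ofLp_injective 2 ?_
    simp [L]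
  have h2 : ‖iteratedFDeriv ℝ n (fun p => a (pt x p)) p‖ ≤
      ‖iteratedFDeriv ℝ n a (pt x p)‖ * ‖L‖ ^ n := by
    rw [h1, L.iteratedFDeriv_comp_right (n := (⊤ : ℕ∞)) _ _ (by exact_mod_cast le_top),
      iteratedFDeriv_comp_add_right]
    · refine (ContinuousMultilinearMap.norm_compContinuousLinearMap_le _ _).trans ?_
      simp [hz]
    · exact (a.smooth ⊤).comp (contDiff_id.add contDiff_const)
  calc ‖x‖ ^ m * (‖p‖ ^ k * ‖iteratedFDeriv ℝ n (fun p => a (pt x p)) p‖)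
      ≤ ‖pt x p‖ ^ m * (‖pt x p‖ ^ k * (‖iteratedFDeriv ℝ n a (pt x p)‖ * ‖L‖ ^ n)) := by
        gcongr
    _ = (‖pt x p‖ ^ (m + k) * ‖iteratedFDeriv ℝ n a (pt x p)‖) * ‖L‖ ^ n := by
        rw [pow_add]; ring
    _ ≤ C * ‖L‖ ^ n := by gcongr; exact hC _

/-- The slice `p ↦ a(x, p)` of a Schwartz function. -/
def slice {d : ℕ} (a : 𝓢(Phase d, ℂ)) (x : Config d) : 𝓢(Config d, ℂ) where
  toFun p := a (pt x p)
  smooth' := slice_contDiff a x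
  decay' k n := by
    obtain ⟨C, hC⟩ := slice_bound a 0 k n
    exact ⟨C, fun p => by simpa using hC x p⟩

theorem slice_fourier_decay {d : ℕ} (a : 𝓢(Phase d, ℂ)) (m k : ℕ) :
    ∃ C, 0 ≤ C ∧ ∀ x w : Config d,
      ‖x‖ ^ m * ‖w‖ ^ k * ‖FourierTransform.fourier (slice a x) w‖ ≤ C := by
  have hcont : Continuous ((SchwartzMap.seminorm ℂ k 0).comp
      (FourierTransform.fourierCLM ℂ 𝓢(Config d, ℂ)).toLinearMap) :=
    ((schwartz_withSeminorms ℂ (Config d) ℂ).continuous_seminorm (k, 0)).comp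
      (FourierTransform.fourierCLM ℂ 𝓢(Config d, ℂ)).continuous
  obtain ⟨s, K, -, hK⟩ := Seminorm.bound_of_continuous
    (schwartz_withSeminorms ℂ (Config d) ℂ) _ hcont
  choose B hB using fun i : ℕ × ℕ => slice_bound a m i.1 i.2
  have hB0 : ∀ i, 0 ≤ B i := fun i => le_trans (by positivity) (hB i 0 0)
  refine ⟨K * ∑ i ∈ s, B i, mul_nonneg K.2 (Finset.sum_nonneg fun i _ => hB0 i),
    fun x w => ?_⟩
  have h1 : ‖w‖ ^ k * ‖FourierTransform.fourier (slice a x) w‖ ≤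
      K * (s.sup (schwartzSeminormFamily ℂ (Config d) ℂ)) (slice a x) := by
    refine le_trans ?_ (hK (slice a x))
    exact SchwartzMap.norm_pow_mul_le_seminorm ℂ (FourierTransform.fourier (slice a x)) k w
  have h2 : (s.sup (schwartzSeminormFamily ℂ (Config d) ℂ)) (slice a x) ≤
      ∑ i ∈ s, SchwartzMap.seminorm ℂ i.1 i.2 (slice a x) := by
    have := Seminorm.finset_sup_le_sum (schwartzSeminormFamily ℂ (Config d) ℂ) s
    refine (this (slice a x)).trans (le_of_eq ?_)
    simp [schwartzSeminormFamily]
  have h3 : ∀ i : ℕ × ℕ, ‖x‖ ^ m * SchwartzMap.seminorm ℂ i.1 i.2 (slice a x) ≤ B i := by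
    intro i
    have : SchwartzMap.seminorm ℂ i.1 i.2 ((‖x‖ ^ m : ℝ) • slice a x) ≤ B i := by
      refine SchwartzMap.seminorm_le_bound ℂ i.1 i.2 _ (hB0 i) fun p => ?_
      have e : (((‖x‖ ^ m : ℝ) • slice a x : 𝓢(Config d, ℂ)) : Config d → ℂ) =
          (‖x‖ ^ m : ℝ) • (fun p => a (pt x p)) := rfl
      rw [e, iteratedFDeriv_const_smul_apply
        ((slice_contDiff a x).of_le (by exact_mod_cast le_top)).contDiffAt, norm_smul,
        Real.norm_of_nonneg (by positivity)]
      have := hB i x p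
      linarith
    refine le_trans (le_of_eq ?_) this
    have e2 : ((‖x‖ ^ m : ℝ) • slice a x : 𝓢(Config d, ℂ)) = ((‖x‖ ^ m : ℝ) : ℂ) • slice a x := by
      ext p
      simp
    rw [e2, map_smul_eq_mul, Complex.norm_real, Real.norm_of_nonneg (by positivity)]
  calc ‖x‖ ^ m * ‖w‖ ^ k * ‖FourierTransform.fourier (slice a x) w‖
      = ‖x‖ ^ m * (‖w‖ ^ k * ‖FourierTransform.fourier (slice a x) w‖) := by ring
    _ ≤ ‖x‖ ^ m * (K * ∑ i ∈ s, SchwartzMap.seminorm ℂ i.1 i.2 (slice a x)) := by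
        exact mul_le_mul_of_nonneg_left (h1.trans (mul_le_mul_of_nonneg_left h2 K.2))
          (by positivity)
    _ = K * ∑ i ∈ s, ‖x‖ ^ m * SchwartzMap.seminorm ℂ i.1 i.2 (slice a x) := by
        rw [Finset.mul_sum, Finset.mul_sum, Finset.mul_sum]
        refine Finset.sum_congr rfl fun i _ => by ring
    _ ≤ K * ∑ i ∈ s, B i := by
        refine mul_le_mul_of_nonneg_left (Finset.sum_le_sum fun i _ => h3 i) K.2

theorem weylKer_eq_fourier {d : ℕ} {ε : ℝ} (hε : 0 < ε) (a : 𝓢(Phase d, ℂ)) (q y : Config d) :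
    weylKer ε a q y = FourierTransform.fourier (slice a ((2 : ℝ)⁻¹ • (q + y)))
      ((-(2 * Real.pi * ε)⁻¹) • (q - y)) := by
  rw [SchwartzMap.fourier_coe, Real.fourier_eq']
  refine integral_congr_ae (Filter.Eventually.of_forall fun p => ?_)
  have : ((-2 * Real.pi * inner ℝ p ((-(2 * Real.pi * ε)⁻¹) • (q - y)) : ℝ) : ℂ) * Complex.I =
      Complex.I * ((inner ℝ (q - y) p / ε : ℝ) : ℂ) := by
    rw [mul_comm]
    congr 2
    rw [inner_smul_right, real_inner_comm]
    field_simp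
  simp only [smul_eq_mul]
  rw [this, mul_comm]
  rfl

theorem weylKer_decay {d : ℕ} {ε : ℝ} (hε : 0 < ε) (a : 𝓢(Phase d, ℂ)) (N : ℕ) :
    ∃ C, 0 ≤ C ∧ ∀ q y : Config d,
      ‖weylKer ε a q y‖ ≤ C * (((1 + ‖q‖) ^ N)⁻¹ * ((1 + ‖y‖) ^ N)⁻¹) := by
  obtain ⟨C0, hC0, h0⟩ := slice_fourier_decay a 0 0
  obtain ⟨C1, hC1, h1⟩ := slice_fourier_decay a (2 * N) 0
  obtain ⟨C2, hC2, h2⟩ := slice_fourier_decay a 0 (2 * N)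
  obtain ⟨C3, hC3, h3⟩ := slice_fourier_decay a (2 * N) (2 * N)
  set κ : ℝ := 2 * Real.pi * ε with hκ
  have hκ0 : 0 < κ := by positivity
  set T : ℝ := κ ^ (2 * N) with hT
  have hT0 : 0 < T := by positivity
  refine ⟨4 ^ (2 * N) * (C0 + C1 + T * C2 + T * C3), by positivity, fun q y => ?_⟩
  rw [← mul_inv, ← div_eq_mul_inv, le_div_iff₀ (by positivity)]
  set x : Config d := (2 : ℝ)⁻¹ • (q + y) with hx
  set v : Config d := q - y with hv
  set F : ℝ := ‖weylKer ε a q y‖ with hF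
  have hF0 : 0 ≤ F := norm_nonneg _
  have hw : ‖(-κ⁻¹) • v‖ = κ⁻¹ * ‖v‖ := by
    rw [norm_smul, norm_neg, Real.norm_of_nonneg (by positivity)]
  have hFe : F = ‖FourierTransform.fourier (slice a x) ((-κ⁻¹) • v)‖ := by
    rw [hF, weylKer_eq_fourier hε]
  have hV : ‖v‖ ^ (2 * N) = T * ‖(-κ⁻¹) • v‖ ^ (2 * N) := by
    rw [hw, hT, ← mul_pow]
    congr 1
    field_simp
  have b0 : F ≤ C0 := by
    have := h0 x ((-κ⁻¹) • v)
    rw [← hFe] at this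
    simpa using this
  have b1 : ‖x‖ ^ (2 * N) * F ≤ C1 := by
    have := h1 x ((-κ⁻¹) • v)
    rw [← hFe] at this
    simpa using this
  have b2 : ‖v‖ ^ (2 * N) * F ≤ T * C2 := by
    have := h2 x ((-κ⁻¹) • v)
    rw [← hFe, pow_zero, one_mul] at this
    rw [hV, mul_assoc]
    gcongr
  have b3 : ‖x‖ ^ (2 * N) * ‖v‖ ^ (2 * N) * F ≤ T * C3 := by
    have := h3 x ((-κ⁻¹) • v)
    rw [← hFe] at this
    rw [hV]
    calc _ = T * (‖x‖ ^ (2 * N) * ‖(-κ⁻¹) • v‖ ^ (2 * N) * F) := by ring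
      _ ≤ _ := by gcongr
  have hq : 1 + ‖q‖ ≤ (1 + ‖x‖) * (1 + ‖v‖) := by
    have e : q = x + (2 : ℝ)⁻¹ • v := by
      rw [hx, hv, ← smul_add, add_add_sub_cancel, ← two_smul ℝ q, smul_smul]; simp
    have : ‖q‖ ≤ ‖x‖ + ‖v‖ := by
      calc ‖q‖ = ‖x + (2 : ℝ)⁻¹ • v‖ := by rw [← e]
        _ ≤ ‖x‖ + ‖(2 : ℝ)⁻¹ • v‖ := norm_add_le _ _
        _ ≤ ‖x‖ + ‖v‖ := by
          rw [norm_smul (2 : ℝ)⁻¹ v, Real.norm_of_nonneg (by norm_num)]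
          linarith [norm_nonneg v]
    nlinarith [norm_nonneg x, norm_nonneg v]
  have hy : 1 + ‖y‖ ≤ (1 + ‖x‖) * (1 + ‖v‖) := by
    have e : y = x - (2 : ℝ)⁻¹ • v := by
      rw [hx, hv, ← smul_sub, add_sub_sub_cancel, ← two_smul ℝ y, smul_smul]; simp
    have : ‖y‖ ≤ ‖x‖ + ‖v‖ := by
      calc ‖y‖ = ‖x - (2 : ℝ)⁻¹ • v‖ := by rw [← e]
        _ ≤ ‖x‖ + ‖(2 : ℝ)⁻¹ • v‖ := norm_sub_le _ _
        _ ≤ ‖x‖ + ‖v‖ := by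
          rw [norm_smul (2 : ℝ)⁻¹ v, Real.norm_of_nonneg (by norm_num)]
          linarith [norm_nonneg v]
    nlinarith [norm_nonneg x, norm_nonneg v]
  have hpow : ∀ t : ℝ, 0 ≤ t → (1 + t) ^ (2 * N) ≤ 2 ^ (2 * N) * (1 + t ^ (2 * N)) := by
    intro t ht
    rcases le_total t 1 with h | h
    · calc (1 + t) ^ (2 * N) ≤ 2 ^ (2 * N) := by gcongr; linarith
        _ ≤ _ := le_mul_of_one_le_right (by positivity) (by simp [pow_nonneg ht])
    · calc (1 + t) ^ (2 * N) ≤ (2 * t) ^ (2 * N) := by gcongr; linarith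
        _ = 2 ^ (2 * N) * t ^ (2 * N) := mul_pow _ _ _
        _ ≤ _ := by gcongr; linarith
  calc F * ((1 + ‖q‖) ^ N * (1 + ‖y‖) ^ N)
      ≤ F * (((1 + ‖x‖) * (1 + ‖v‖)) ^ N * ((1 + ‖x‖) * (1 + ‖v‖)) ^ N) := by gcongr
    _ = F * ((1 + ‖x‖) ^ (2 * N) * (1 + ‖v‖) ^ (2 * N)) := by
        rw [← pow_add, ← two_mul, mul_pow]
    _ ≤ F * ((2 ^ (2 * N) * (1 + ‖x‖ ^ (2 * N))) * (2 ^ (2 * N) * (1 + ‖v‖ ^ (2 * N)))) := by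
        gcongr
        · exact hpow _ (norm_nonneg _)
        · exact hpow _ (norm_nonneg _)
    _ = 4 ^ (2 * N) * (F + ‖x‖ ^ (2 * N) * F + ‖v‖ ^ (2 * N) * F +
          ‖x‖ ^ (2 * N) * ‖v‖ ^ (2 * N) * F) := by
        rw [show (4 : ℝ) = 2 * 2 by norm_num, mul_pow]; ring
    _ ≤ 4 ^ (2 * N) * (C0 + C1 + T * C2 + T * C3) := by gcongr

theorem memLp_weight (d : ℕ) :
    MemLp (fun y : Config d => ((1 + ‖y‖) ^ (d + 1))⁻¹) 2 volume := by
  have hc : Continuous (fun y : Config d => ((1 + ‖y‖) ^ (d + 1))⁻¹) :=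
    Continuous.inv₀ (by fun_prop) fun y => by positivity
  rw [memLp_two_iff_integrable_sq hc.aestronglyMeasurable]
  have h := integrable_one_add_norm (E := Config d) (μ := volume) (r := (d + 1 : ℕ))
    (by simp)
  refine h.mono' (hc.pow 2).aestronglyMeasurable (Filter.Eventually.of_forall fun y => ?_)
  rw [Real.rpow_neg (by positivity), Real.rpow_natCast, Real.norm_of_nonneg (by positivity)]
  refine pow_le_of_le_one (by positivity) (inv_le_one_of_one_le₀ ?_) two_ne_zero
  exact one_le_pow₀ (by simp)

theorem weylKer_aesm {d : ℕ} (ε : ℝ) (a : 𝓢(Phase d, ℂ)) (q : Config d) :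
    AEStronglyMeasurable (weylKer ε a q) volume := by
  have : StronglyMeasurable (Function.uncurry fun (y p : Config d) =>
      a (pt ((2 : ℝ)⁻¹ • (q + y)) p) *
      Complex.exp (Complex.I * ((inner ℝ (q - y) p / ε : ℝ) : ℂ))) := by
    refine Continuous.stronglyMeasurable ?_
    simp only [Function.uncurry_def]
    have := a.continuous
    have h2 := (WithLp.prodContinuousLinearEquiv 2 ℝ (Config d) (Config d)).symm.continuous
    refine Continuous.mul (this.comp (h2.comp (by fun_prop))) (by fun_prop)
  exact (this.integral_prod_right).aestronglyMeasurable

theorem weylFun_aesm {d : ℕ} (ε : ℝ) (a : 𝓢(Phase d, ℂ)) (ψ : L2 d) :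
    AEStronglyMeasurable (weylFun ε a ψ) volume := by
  have h : StronglyMeasurable (Function.uncurry fun (x : Config d × Config d) (p : Config d) =>
      a (pt ((2 : ℝ)⁻¹ • (x.1 + x.2)) p) *
      Complex.exp (Complex.I * ((inner ℝ (x.1 - x.2) p / ε : ℝ) : ℂ)) * ψ x.2) := by
    refine StronglyMeasurable.mul (Continuous.stronglyMeasurable ?_) ?_
    · have := a.continuous
      have h2 := (WithLp.prodContinuousLinearEquiv 2 ℝ (Config d) (Config d)).symm.continuous
      refine Continuous.mul (this.comp (h2.comp (by fun_prop))) (by fun_prop)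
    · exact (Lp.stronglyMeasurable ψ).comp_measurable (by fun_prop)
  have h' : StronglyMeasurable (Function.uncurry fun (q y : Config d) => ∫ p : Config d,
      a (pt ((2 : ℝ)⁻¹ • (q + y)) p) *
      Complex.exp (Complex.I * ((inner ℝ (q - y) p / ε : ℝ) : ℂ)) * ψ y) :=
    h.integral_prod_right
  exact (h'.integral_prod_right.const_mul _).aestronglyMeasurable

theorem weight_mul_integrable {d : ℕ} (ψ : L2 d) :
    Integrable (fun y : Config d => ((1 + ‖y‖) ^ (d + 1))⁻¹ * ‖ψ y‖) :=
  (memLp_weight d).integrable_mul (Lp.memLp ψ).norm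

theorem weylKer_integrable {d : ℕ} {ε : ℝ} (hε : 0 < ε) (a : 𝓢(Phase d, ℂ)) (ψ : L2 d)
    (q : Config d) : Integrable (fun y => weylKer ε a q y * ψ y) := by
  obtain ⟨C, hC, h⟩ := weylKer_decay hε a (d + 1)
  refine ((weight_mul_integrable ψ).const_mul (C * ((1 + ‖q‖) ^ (d + 1))⁻¹)).mono'
    ((weylKer_aesm ε a q).mul (Lp.aestronglyMeasurable ψ))
    (Filter.Eventually.of_forall fun y => ?_)
  rw [norm_mul]
  calc ‖weylKer ε a q y‖ * ‖ψ y‖ ≤ _ := mul_le_mul_of_nonneg_right (h q y) (norm_nonneg _)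
    _ = _ := by ring

theorem weight_integral_le (d : ℕ) :
    ∃ C, 0 ≤ C ∧ ∀ ψ : L2 d, ∫ y : Config d, ((1 + ‖y‖) ^ (d + 1))⁻¹ * ‖ψ y‖ ≤ C * ‖ψ‖ := by
  refine ⟨‖(memLp_weight d).toLp _‖, norm_nonneg _, fun ψ => ?_⟩
  have hn : ‖(Lp.memLp ψ).norm.toLp‖ = ‖ψ‖ := by
    rw [Lp.norm_toLp, eLpNorm_norm, Lp.norm_def]
  rw [← hn]
  refine le_trans (le_of_eq ?_)
    (real_inner_le_norm ((memLp_weight d).toLp _) (Lp.memLp ψ).norm.toLp)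
  rw [L2.inner_def]
  refine integral_congr_ae ?_
  filter_upwards [(memLp_weight d).coeFn_toLp, (Lp.memLp ψ).norm.coeFn_toLp] with y h1 h2
  rw [h1, h2]
  simp [mul_comm]

theorem weylFun_bound {d : ℕ} {ε : ℝ} (hε : 0 < ε) (a : 𝓢(Phase d, ℂ)) :
    ∃ C, 0 ≤ C ∧ ∀ (ψ : L2 d) (q : Config d),
      ‖weylFun ε a ψ q‖ ≤ C * ‖ψ‖ * ‖((1 + ‖q‖) ^ (d + 1))⁻¹‖ := by
  obtain ⟨C, hC, h⟩ := weylKer_decay hε a (d + 1)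
  obtain ⟨B, hB, hw⟩ := weight_integral_le d
  refine ⟨((2 * Real.pi * ε) ^ d)⁻¹ * (C * B), by positivity, fun ψ q => ?_⟩
  rw [weylFun_eq, norm_mul, Complex.norm_real, Real.norm_of_nonneg (by positivity),
    Real.norm_of_nonneg (by positivity)]
  have : ‖∫ y : Config d, weylKer ε a q y * ψ y‖ ≤
      ∫ y : Config d, (C * ((1 + ‖q‖) ^ (d + 1))⁻¹) * (((1 + ‖y‖) ^ (d + 1))⁻¹ * ‖ψ y‖) := by
    refine norm_integral_le_of_norm_le ((weight_mul_integrable ψ).const_mul _)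
      (Filter.Eventually.of_forall fun y => ?_)
    rw [norm_mul]
    calc ‖weylKer ε a q y‖ * ‖ψ y‖ ≤ _ := mul_le_mul_of_nonneg_right (h q y) (norm_nonneg _)
      _ = _ := by ring
  rw [integral_const_mul] at this
  calc ((2 * Real.pi * ε) ^ d)⁻¹ * ‖∫ y : Config d, weylKer ε a q y * ψ y‖
      ≤ ((2 * Real.pi * ε) ^ d)⁻¹ * ((C * ((1 + ‖q‖) ^ (d + 1))⁻¹) * (B * ‖ψ‖)) := by
        gcongr
        exact this.trans (mul_le_mul_of_nonneg_left (hw ψ) (by positivity))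
    _ = _ := by ring

theorem memLp_weylFun {d : ℕ} {ε : ℝ} (hε : 0 < ε) (a : 𝓢(Phase d, ℂ)) (ψ : L2 d) :
    MemLp (weylFun ε a ψ) 2 volume := by
  obtain ⟨C, -, h⟩ := weylFun_bound hε a
  exact MemLp.of_le_mul (memLp_weight d) (weylFun_aesm ε a ψ) (Filter.Eventually.of_forall (h ψ))

theorem weylFun_add {d : ℕ} {ε : ℝ} (hε : 0 < ε) (a : 𝓢(Phase d, ℂ)) (ψ φ : L2 d) :
    weylFun ε a ↑↑(ψ + φ) = weylFun ε a ψ + weylFun ε a φ := by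
  funext q
  rw [Pi.add_apply, weylFun_eq, weylFun_eq, weylFun_eq, ← mul_add,
    ← integral_add (weylKer_integrable hε a ψ q) (weylKer_integrable hε a φ q)]
  congr 1
  refine integral_congr_ae ?_
  filter_upwards [Lp.coeFn_add ψ φ] with y hy
  rw [hy, Pi.add_apply, mul_add]

theorem weylFun_smul {d : ℕ} (ε : ℝ) (a : 𝓢(Phase d, ℂ)) (c : ℂ) (ψ : L2 d) :
    weylFun ε a ↑↑(c • ψ) = c • weylFun ε a ψ := by
  funext q
  have h : ∫ y : Config d, weylKer ε a q y * (c • ψ : L2 d) y =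
      c * ∫ y : Config d, weylKer ε a q y * ψ y := by
    rw [← integral_const_mul]
    refine integral_congr_ae ?_
    filter_upwards [Lp.coeFn_smul c ψ] with y hy
    rw [hy, Pi.smul_apply, smul_eq_mul, mul_left_comm]
  rw [Pi.smul_apply, weylFun_eq, weylFun_eq, h, smul_eq_mul, mul_left_comm]

/-- The Weyl quantization `op^We(a)` of a Schwartz function, as a bounded operator on `L²(ℝ^d)`:
the class of `ψ` is sent to the class of `weylFun ε a ψ`. -/
def opWe {d : ℕ} (ε : ℝ) (hε : 0 < ε) (a : 𝓢(Phase d, ℂ)) : L2 d →L[ℂ] L2 d :=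
  LinearMap.mkContinuousOfExistsBound
    { toFun := fun ψ => (memLp_weylFun hε a ψ).toLp (weylFun ε a ψ)
      map_add' := fun ψ φ => by
        rw [← MemLp.toLp_add]
        exact MemLp.toLp_congr _ _ (by rw [weylFun_add hε])
      map_smul' := fun c ψ => by
        rw [RingHom.id_apply, ← MemLp.toLp_const_smul]
        exact MemLp.toLp_congr _ _ (by rw [weylFun_smul]) }
    (by
      obtain ⟨C, hC, h⟩ := weylFun_bound hε a
      refine ⟨C * ‖(memLp_weight d).toLp _‖, fun ψ => ?_⟩
      have : ‖(memLp_weylFun hε a ψ).toLp (weylFun ε a ψ)‖ ≤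
          (C * ‖ψ‖) * ‖(memLp_weight d).toLp _‖ := by
        refine Lp.norm_le_mul_norm_of_ae_le_mul ?_
        filter_upwards [(memLp_weylFun hε a ψ).coeFn_toLp, (memLp_weight d).coeFn_toLp]
          with q h1 h2
        rw [h1, h2]
        exact h ψ q
      refine le_trans this (le_of_eq ?_)
      ring)

/-- `opWe` acts by the integral formula `weylFun`. -/
theorem opWe_coeFn {d : ℕ} (ε : ℝ) (hε : 0 < ε) (a : 𝓢(Phase d, ℂ)) (ψ : L2 d) :
    opWe ε hε a ψ =ᵐ[volume] weylFun ε a ψ :=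
  MemLp.coeFn_toLp (memLp_weylFun hε a ψ)

/-! ### Anti-Wick quantization -/

theorem gaussian_contDiff (d : ℕ) (ε : ℝ) :
    ContDiff ℝ (⊤ : ℕ∞) (fun z : Phase d => Real.exp (-‖z‖ ^ 2 / ε)) :=
  Real.contDiff_exp.comp (((contDiff_norm_sq ℝ).neg).div_const ε)

theorem gaussian_decay (d : ℕ) {ε : ℝ} (hε : 0 < ε) (k n : ℕ) :
    ∃ C, ∀ z : Phase d,
      ‖z‖ ^ k * ‖iteratedFDeriv ℝ n (fun z : Phase d => Real.exp (-‖z‖ ^ 2 / ε)) z‖ ≤ C := by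
  have htg : Function.HasTemperateGrowth (fun z : Phase d => -‖z‖ ^ 2 / ε) := by
    have := (Function.HasTemperateGrowth.const (E := Phase d) (-ε⁻¹)).mul
      (Function.hasTemperateGrowth_norm_sq (Phase d))
    have e : (fun z : Phase d => -‖z‖ ^ 2 / ε) =
        (fun _ : Phase d => -ε⁻¹) * fun z : Phase d => ‖z‖ ^ 2 := by
      funext z
      simp only [Pi.mul_apply]
      ring
    rw [e]
    exact this
  obtain ⟨l, C, hC, hgrowth⟩ := htg.norm_iteratedFDeriv_le_uniform n
  refine ⟨n.factorial * (C + 1) ^ n * ((k + l * n).factorial * Real.exp (1 + ε / 4)),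
    fun z => ?_⟩
  have hexp : ∀ i ≤ n, ‖iteratedFDeriv ℝ i Real.exp (-‖z‖ ^ 2 / ε)‖ ≤
      Real.exp (-‖z‖ ^ 2 / ε) := by
    intro i _
    rw [norm_iteratedFDeriv_eq_norm_iteratedDeriv, iteratedDeriv_eq_iterate, Real.iter_deriv_exp,
      Real.norm_of_nonneg (Real.exp_pos _).le]
  have hD : ∀ i, 1 ≤ i → i ≤ n → ‖iteratedFDeriv ℝ i (fun z : Phase d => -‖z‖ ^ 2 / ε) z‖ ≤
      ((C + 1) * (1 + ‖z‖) ^ l) ^ i := by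
    intro i h1 h2
    refine (hgrowth i h2 z).trans ?_
    have h1z : (1 : ℝ) ≤ 1 + ‖z‖ := by simp
    calc C * (1 + ‖z‖) ^ l ≤ (C + 1) * (1 + ‖z‖) ^ l := by gcongr; simp
      _ ≤ _ := le_self_pow₀ (one_le_mul_of_one_le_of_one_le (by simp [hC]) (one_le_pow₀ h1z))
        (by omega)
  have key := norm_iteratedFDeriv_comp_le (n := n) (N := (⊤ : ℕ∞)) Real.contDiff_exp htg.1
    (by exact_mod_cast le_top) z hexp hD
  have hpow : (1 + ‖z‖) ^ (k + l * n) ≤ (k + l * n).factorial * Real.exp (1 + ‖z‖) := by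
    have := Real.pow_div_factorial_le_exp (x := 1 + ‖z‖) (by positivity) (k + l * n)
    rwa [div_le_iff₀' (by positivity)] at this
  have hq : 1 + ‖z‖ + -‖z‖ ^ 2 / ε ≤ 1 + ε / 4 := by
    have : ‖z‖ + -‖z‖ ^ 2 / ε - ε / 4 = -((‖z‖ - ε / 2) ^ 2) / ε := by
      field_simp
      ring
    have h2 : -((‖z‖ - ε / 2) ^ 2) / ε ≤ 0 :=
      div_nonpos_of_nonpos_of_nonneg (by simp [sq_nonneg]) hε.le
    linarith
  calc ‖z‖ ^ k * ‖iteratedFDeriv ℝ n (fun z : Phase d => Real.exp (-‖z‖ ^ 2 / ε)) z‖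
      ≤ (1 + ‖z‖) ^ k * (n.factorial * Real.exp (-‖z‖ ^ 2 / ε) *
          ((C + 1) * (1 + ‖z‖) ^ l) ^ n) := by
        gcongr
        · simp
        · exact key
    _ = n.factorial * (C + 1) ^ n * ((1 + ‖z‖) ^ (k + l * n) * Real.exp (-‖z‖ ^ 2 / ε)) := by
        rw [mul_pow, pow_add, pow_mul]; ring
    _ ≤ n.factorial * (C + 1) ^ n * ((k + l * n).factorial * Real.exp (1 + ‖z‖) *
          Real.exp (-‖z‖ ^ 2 / ε)) := by gcongr
    _ = n.factorial * (C + 1) ^ n * ((k + l * n).factorial *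
          Real.exp (1 + ‖z‖ + -‖z‖ ^ 2 / ε)) := by rw [Real.exp_add (1 + ‖z‖)]; ring
    _ ≤ _ := by gcongr

/-- The phase space Gaussian `G_{ε/2}(z) = (πε)^{-d} e^{-|z|²/ε}`. -/
def gaussian (d : ℕ) (ε : ℝ) (hε : 0 < ε) : 𝓢(Phase d, ℝ) where
  toFun z := ((Real.pi * ε) ^ d)⁻¹ * Real.exp (-‖z‖ ^ 2 / ε)
  smooth' := contDiff_const.mul (gaussian_contDiff d ε)
  decay' k n := by
    obtain ⟨C, hC⟩ := gaussian_decay d hε k n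
    refine ⟨((Real.pi * ε) ^ d)⁻¹ * C, fun z => ?_⟩
    have e : (fun z : Phase d => ((Real.pi * ε) ^ d)⁻¹ * Real.exp (-‖z‖ ^ 2 / ε)) =
        ((Real.pi * ε) ^ d)⁻¹ • (fun z : Phase d => Real.exp (-‖z‖ ^ 2 / ε)) := rfl
    rw [e, iteratedFDeriv_const_smul_apply
      ((gaussian_contDiff d ε).of_le (by exact_mod_cast le_top)).contDiffAt, norm_smul,
      Real.norm_of_nonneg (by positivity), mul_left_comm]
    gcongr
    exact hC z

/-- The convolution `a * G_{ε/2}`. -/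
def gaussConv {d : ℕ} (ε : ℝ) (hε : 0 < ε) (a : 𝓢(Phase d, ℂ)) : 𝓢(Phase d, ℂ) :=
  SchwartzMap.convolution (ContinuousLinearMap.mul ℂ ℂ) a (toComplex (gaussian d ε hε))

theorem gaussConv_apply {d : ℕ} (ε : ℝ) (hε : 0 < ε) (a : 𝓢(Phase d, ℂ)) (z : Phase d) :
    gaussConv ε hε a z =
      ∫ ζ : Phase d, a ζ * ((((Real.pi * ε) ^ d)⁻¹ * Real.exp (-‖z - ζ‖ ^ 2 / ε) : ℝ) : ℂ) := by
  rw [gaussConv, SchwartzMap.convolution_apply]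
  rfl

/-- The Anti-Wick quantization `op^AW(a) = op^We(a * G_{ε/2})`. -/
def opAW {d : ℕ} (ε : ℝ) (hε : 0 < ε) (a : 𝓢(Phase d, ℂ)) : L2 d →L[ℂ] L2 d :=
  opWe ε hε (gaussConv ε hε a)

/-! ### The coefficients of the expansion -/

theorem comp_fst_bound {d : ℕ} (a : 𝓢(Phase d, ℂ)) (i : ℕ) (x : Phase d × Phase d) :
    ‖iteratedFDeriv ℝ i (fun x : Phase d × Phase d => a x.1) x‖ ≤ ‖iteratedFDeriv ℝ i a x.1‖ := by
  have h := (ContinuousLinearMap.fst ℝ (Phase d) (Phase d)).iteratedFDeriv_comp_right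
    (a.smooth ⊤) x (i := i) (by exact_mod_cast le_top)
  change ‖iteratedFDeriv ℝ i (a ∘ ContinuousLinearMap.fst ℝ (Phase d) (Phase d)) x‖ ≤ _
  rw [h]
  refine (ContinuousMultilinearMap.norm_compContinuousLinearMap_le _ _).trans ?_
  refine mul_le_of_le_one_right (norm_nonneg _) ?_
  exact Finset.prod_le_one (fun _ _ => norm_nonneg _)
    fun _ _ => ContinuousLinearMap.norm_fst_le ℝ _ _

theorem comp_snd_bound {d : ℕ} (a : 𝓢(Phase d, ℂ)) (i : ℕ) (x : Phase d × Phase d) :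
    ‖iteratedFDeriv ℝ i (fun x : Phase d × Phase d => a x.2) x‖ ≤ ‖iteratedFDeriv ℝ i a x.2‖ := by
  have h := (ContinuousLinearMap.snd ℝ (Phase d) (Phase d)).iteratedFDeriv_comp_right
    (a.smooth ⊤) x (i := i) (by exact_mod_cast le_top)
  change ‖iteratedFDeriv ℝ i (a ∘ ContinuousLinearMap.snd ℝ (Phase d) (Phase d)) x‖ ≤ _
  rw [h]
  refine (ContinuousMultilinearMap.norm_compContinuousLinearMap_le _ _).trans ?_
  refine mul_le_of_le_one_right (norm_nonneg _) ?_
  exact Finset.prod_le_one (fun _ _ => norm_nonneg _)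
    fun _ _ => ContinuousLinearMap.norm_snd_le ℝ _ _

/-- The tensor product `(z, w) ↦ a(z) b(w)`. -/
def tensor {d : ℕ} (a b : 𝓢(Phase d, ℂ)) : 𝓢(Phase d × Phase d, ℂ) where
  toFun x := a x.1 * b x.2
  smooth' := ((a.smooth ⊤).comp contDiff_fst).mul ((b.smooth ⊤).comp contDiff_snd)
  decay' k n := by
    refine ⟨∑ i ∈ Finset.range (n + 1), (n.choose i : ℝ) *
      (SchwartzMap.seminorm ℝ k i a * SchwartzMap.seminorm ℝ 0 (n - i) b +
        SchwartzMap.seminorm ℝ 0 i a * SchwartzMap.seminorm ℝ k (n - i) b), fun x => ?_⟩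
    have hmul := norm_iteratedFDeriv_mul_le (𝕜 := ℝ) (N := (⊤ : ℕ∞)) (n := n)
      ((a.smooth ⊤).comp contDiff_fst : ContDiff ℝ _ fun x : Phase d × Phase d => a x.1)
      ((b.smooth ⊤).comp contDiff_snd : ContDiff ℝ _ fun x : Phase d × Phase d => b x.2)
      x (by exact_mod_cast le_top)
    have hnorm : ‖x‖ ^ k ≤ ‖x.1‖ ^ k + ‖x.2‖ ^ k := by
      rw [Prod.norm_def]
      rcases max_choice ‖x.1‖ ‖x.2‖ with h | h <;> rw [h]
      · exact le_add_of_nonneg_right (by positivity)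
      · exact le_add_of_nonneg_left (by positivity)
    refine (mul_le_mul_of_nonneg_left hmul (by positivity)).trans ?_
    rw [Finset.mul_sum]
    refine Finset.sum_le_sum fun i _ => ?_
    have a0 : ‖iteratedFDeriv ℝ i a x.1‖ ≤ SchwartzMap.seminorm ℝ 0 i a :=
      SchwartzMap.norm_iteratedFDeriv_le_seminorm ℝ a i x.1
    have b0 : ‖iteratedFDeriv ℝ (n - i) b x.2‖ ≤ SchwartzMap.seminorm ℝ 0 (n - i) b :=
      SchwartzMap.norm_iteratedFDeriv_le_seminorm ℝ b (n - i) x.2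
    have ak := SchwartzMap.le_seminorm ℝ k i a x.1
    have bk := SchwartzMap.le_seminorm ℝ k (n - i) b x.2
    set A := ‖iteratedFDeriv ℝ i a x.1‖
    set B := ‖iteratedFDeriv ℝ (n - i) b x.2‖
    have hA : 0 ≤ A := norm_nonneg _
    have hB : 0 ≤ B := norm_nonneg _
    calc ‖x‖ ^ k * ((n.choose i : ℝ) *
          ‖iteratedFDeriv ℝ i (fun x : Phase d × Phase d => a x.1) x‖ *
          ‖iteratedFDeriv ℝ (n - i) (fun x : Phase d × Phase d => b x.2) x‖)
        ≤ (‖x.1‖ ^ k + ‖x.2‖ ^ k) * ((n.choose i : ℝ) * A * B) := by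
          gcongr
          · exact comp_fst_bound a i x
          · exact comp_snd_bound b (n - i) x
      _ = (n.choose i : ℝ) * ((‖x.1‖ ^ k * A) * B + A * (‖x.2‖ ^ k * B)) := by ring
      _ ≤ _ := by gcongr

/-- Restriction `F ↦ (z ↦ F(z, z))` to the diagonal `w = z`. -/
def diag {d : ℕ} : 𝓢(Phase d × Phase d, ℂ) →L[ℂ] 𝓢(Phase d, ℂ) :=
  SchwartzMap.compCLM ℂ
    (g := fun z : Phase d => (z, z))
    (((ContinuousLinearMap.id ℝ (Phase d)).prod
      (ContinuousLinearMap.id ℝ (Phase d))).hasTemperateGrowth)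
    ⟨1, 1, fun z => by simp [Prod.norm_def]⟩

theorem diag_apply {d : ℕ} (F : 𝓢(Phase d × Phase d, ℂ)) (z : Phase d) :
    diag F z = F (z, z) := rfl

/-- The coordinate direction `∂/∂q_j` of phase space. -/
def dirQ {d : ℕ} (j : Fin d) : Phase d := pt (EuclideanSpace.single j 1) 0

/-- The coordinate direction `∂/∂p_j` of phase space. -/
def dirP {d : ℕ} (j : Fin d) : Phase d := pt 0 (EuclideanSpace.single j 1)

/-- Directional derivative in the first variable `z` of functions of `(z, w)`. -/
def dz {d : ℕ} (u : Phase d) : 𝓢(Phase d × Phase d, ℂ) →L[ℂ] 𝓢(Phase d × Phase d, ℂ) :=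
  LineDeriv.lineDerivOpCLM ℂ 𝓢(Phase d × Phase d, ℂ) ((u, 0) : Phase d × Phase d)

/-- Directional derivative in the second variable `w` of functions of `(z, w)`. -/
def dw {d : ℕ} (u : Phase d) : 𝓢(Phase d × Phase d, ℂ) →L[ℂ] 𝓢(Phase d × Phase d, ℂ) :=
  LineDeriv.lineDerivOpCLM ℂ 𝓢(Phase d × Phase d, ℂ) ((0, u) : Phase d × Phase d)

/-- The operator `(∇_z, ∇_w)`. -/
def gradGrad (d : ℕ) : 𝓢(Phase d × Phase d, ℂ) →L[ℂ] 𝓢(Phase d × Phase d, ℂ) :=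
  ∑ j : Fin d, (dz (dirQ j) ∘L dw (dirQ j) + dz (dirP j) ∘L dw (dirP j))

/-- The operator `(J∇_z, ∇_w)` with `J (q, p) = (p, -q)`, that is `J∇ = (∇_p, -∇_q)`. -/
def symplGrad (d : ℕ) : 𝓢(Phase d × Phase d, ℂ) →L[ℂ] 𝓢(Phase d × Phase d, ℂ) :=
  ∑ j : Fin d, (dz (dirP j) ∘L dw (dirQ j) - dz (dirQ j) ∘L dw (dirP j))

/-- `λ_m(a,b)(z) = ((-1)^m / (2^m m!)) [((∇_z,∇_w) + i (J∇_z,∇_w))^m (a(z) b(w))]_{w = z}`. -/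
def lam {d : ℕ} (m : ℕ) (a b : 𝓢(Phase d, ℂ)) : 𝓢(Phase d, ℂ) :=
  ((-1 : ℂ) ^ m / ((2 : ℂ) ^ m * (m.factorial : ℂ))) •
    diag (((gradGrad d + Complex.I • symplGrad d) ^ m) (tensor a b))

end AntiWick

end

noncomputable section

namespace AntiWick

/-! Everything is computed on plane waves. The Weyl quantization of `z ↦ e^{2πi z·ζ}` is a phase
times a translation (`weylTrans`), hence an isometry of L². A symbol that is a superposition of
waves with integrable weight `F` therefore has an operator of norm at most `∫ ‖F‖`
(`weylFun_of_rep`, `norm_opWe_le`). This L¹ bound on the Fourier side is the only operator estimate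
needed.

Weyl translations compose up to the phase `e^{2π²iε σ(ζ,ω)}`, where σ is `sympl`
(`weylTrans_weylTrans`), and convolution with the Gaussian multiplies the wave of frequency ζ by
`e^{-π²ε|ζ|²}`. So the product of the two Anti-Wick operators is a superposition over pairs (ζ, ω)
with weight `â(ζ) b̂(ω) e^{-π²ε(|ζ|²+|ω|²)} e^{2π²iε σ(ζ,ω)}`, attached to the wave of frequency
ζ+ω. Expanding `|ζ+ω|²` turns this weight into `â(ζ) b̂(ω) e^{-π²ε|ζ+ω|²} exp(-(ε/2) s)` with `s =
-4π²(ζ·ω + iσ(ζ,ω))` (`twisted_gaussian_eq`). The first Gaussian is precisely the Anti-Wick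
smoothing of the outgoing wave, and `s` is the eigenvalue of `(∇_z,∇_w) + i(J∇_z,∇_w)` on the wave
in (z, w) (`isSuperposition_pow`). Taylor expansion of the last exponential thus produces the `λ_m`.

For the remainder, `|e^w - Σ_{m<k} w^m/m!| ≤ |w|^k max(1, e^{Re w})`. The possible growth `e^{2π²ε
ζ·ω}` is absorbed by `e^{-π²ε|ζ+ω|²}`, so the remainder weight is at most `ε^{n+1} |â b̂ s^{n+1}|`,
which is integrable and, after division by `ε^{n+1}`, independent of ε. The remainder symbol is
Schwartz because the Moyal product is (`exists_moyal`). -/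

/-! ### Phases and pointwise Fourier inversion. -/

/-- The phase factor `e^{it}`. -/
def cis (t : ℝ) : ℂ := Complex.exp ((t : ℂ) * Complex.I)

theorem cis_add (s t : ℝ) : cis (s + t) = cis s * cis t := by
  rw [cis, cis, cis, ← Complex.exp_add]; push_cast; ring_nf

@[simp] theorem norm_cis (t : ℝ) : ‖cis t‖ = 1 := Complex.norm_exp_ofReal_mul_I t

@[fun_prop] theorem continuous_cis : Continuous cis := by unfold cis; fun_prop

theorem fourier_eq_cis {V : Type*} [NormedAddCommGroup V] [InnerProductSpace ℝ V]
    [MeasurableSpace V] [BorelSpace V] [FiniteDimensional ℝ V] (f : V → ℂ) (w : V) :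
    FourierTransform.fourier f w = ∫ v, cis (-(2 * Real.pi * inner ℝ v w)) * f v := by
  rw [Real.fourier_eq']
  simp only [cis, smul_eq_mul, neg_mul]

theorem fourierInv_eq_cis {V : Type*} [NormedAddCommGroup V] [InnerProductSpace ℝ V]
    [MeasurableSpace V] [BorelSpace V] [FiniteDimensional ℝ V] (f : V → ℂ) (w : V) :
    FourierTransformInv.fourierInv f w = ∫ v, cis (2 * Real.pi * inner ℝ v w) * f v := by
  rw [Real.fourierInv_eq']
  simp only [cis, smul_eq_mul]

/-- The wave functions on which Fourier inversion holds pointwise. -/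
structure Nice {d : ℕ} (ψ : Config d → ℂ) : Prop where
  cont : Continuous ψ
  int : Integrable ψ
  fint : Integrable (FourierTransform.fourier ψ)

theorem Nice.eq_integral {d : ℕ} {ψ : Config d → ℂ} (h : Nice ψ) (y : Config d) :
    ψ y = ∫ k, cis (2 * Real.pi * inner ℝ k y) * FourierTransform.fourier ψ k := by
  rw [← fourierInv_eq_cis, h.cont.fourierInv_fourier_eq h.int h.fint]

theorem nice_of_schwartz {d : ℕ} (ψ : 𝓢(Config d, ℂ)) : Nice ψ where
  cont := ψ.continuous
  int := ψ.integrable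
  fint := by
    rw [← SchwartzMap.fourier_coe]
    exact (FourierTransform.fourier ψ).integrable

/-! ### Weyl quantization of plane waves and their superpositions. -/

/-- The Weyl translation, the quantization of `z ↦ e^{2πi z·ζ}`. -/
def weylTrans {d : ℕ} (ε : ℝ) (ζ : Phase d) (ψ : Config d → ℂ) (q : Config d) : ℂ :=
  cis (2 * Real.pi * inner ℝ ζ.ofLp.1 (q + (Real.pi * ε) • ζ.ofLp.2)) *
    ψ (q + (2 * Real.pi * ε) • ζ.ofLp.2)

/-- The exponent `d + 1` makes the weight integrable over momenta, and uniformity in the position is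
what justifies exchanging the two integrals in the Weyl formula. -/
theorem symbol_bound {d : ℕ} (c : 𝓢(Phase d, ℂ)) :
    ∃ C, 0 ≤ C ∧ ∀ x p : Config d, ‖c (pt x p)‖ ≤ C * ((1 + ‖p‖) ^ (d + 1))⁻¹ := by
  have h := SchwartzMap.one_add_le_sup_seminorm_apply (𝕜 := ℝ) (m := (d + 1, 0)) le_rfl le_rfl c
  refine ⟨2 ^ (d + 1) * ((Finset.Iic (d + 1, 0)).sup fun m => SchwartzMap.seminorm ℝ m.1 m.2) c,
    mul_nonneg (by positivity) (apply_nonneg _ _), fun x p => ?_⟩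
  · rw [← div_eq_mul_inv, le_div_iff₀ (by positivity)]
    have hp : ‖p‖ ≤ ‖pt x p‖ := by
      rw [WithLp.prod_norm_eq_of_L2]
      exact Real.le_sqrt_of_sq_le (by simp)
    have := h (pt x p)
    rw [norm_iteratedFDeriv_zero] at this
    refine le_trans ?_ this
    rw [mul_comm]
    gcongr

theorem integrable_weight (d : ℕ) :
    Integrable (fun y : Config d => ((1 + ‖y‖) ^ (d + 1))⁻¹) := by
  have h := integrable_one_add_norm (E := Config d) (μ := volume) (r := (d + 1 : ℕ)) (by simp)
  refine h.congr (Filter.Eventually.of_forall fun y => ?_)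
  simp only
  rw [Real.rpow_neg (by positivity), Real.rpow_natCast]

theorem continuous_pt {d : ℕ} : Continuous fun x : Config d × Config d => pt x.1 x.2 :=
  (WithLp.prodContinuousLinearEquiv 2 ℝ (Config d) (Config d)).symm.continuous

theorem inner_pt {d : ℕ} (x p : Config d) (ζ : Phase d) :
    inner ℝ (pt x p) ζ = inner ℝ x ζ.ofLp.1 + inner ℝ p ζ.ofLp.2 :=
  WithLp.prod_inner_apply _ _

theorem measurable_ofLp_fst {d : ℕ} : Measurable fun ζ : Phase d => ζ.ofLp.1 :=
  (by fun_prop : Continuous fun ζ : Phase d => ζ.ofLp.1).measurable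

theorem measurable_ofLp_snd {d : ℕ} : Measurable fun ζ : Phase d => ζ.ofLp.2 :=
  (by fun_prop : Continuous fun ζ : Phase d => ζ.ofLp.2).measurable

/-- With the position integral innermost, a plane-wave symbol turns it into a Fourier transform of
`ψ`, and the remaining momentum integral into an inverse one. -/
theorem weylFun_swap {d : ℕ} (ε : ℝ) (c : 𝓢(Phase d, ℂ)) {ψ : Config d → ℂ}
    (hψ : Integrable ψ) (q : Config d) :
    weylFun ε c ψ q = (((2 * Real.pi * ε) ^ d)⁻¹ : ℝ) * ∫ p : Config d, ∫ y : Config d,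
      c (pt ((2 : ℝ)⁻¹ • (q + y)) p) * cis (inner ℝ (q - y) p / ε) * ψ y := by
  obtain ⟨C, hC, h⟩ := symbol_bound c
  have e : ∀ t : ℝ, Complex.exp (Complex.I * (t : ℂ)) = cis t := fun t => by rw [cis, mul_comm]
  simp only [weylFun, e]
  congr 1
  refine integral_integral_swap ?_
  refine Integrable.mono' (hψ.norm.mul_prod ((integrable_weight d).const_mul C)) ?_ ?_
  · refine AEStronglyMeasurable.mul (Continuous.aestronglyMeasurable ?_) ?_
    · have h1 : Continuous fun x : Config d × Config d => ((2 : ℝ)⁻¹ • (q + x.1), x.2) := by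
        fun_prop
      have h2 : Continuous fun x : Config d × Config d => cis (inner ℝ (q - x.1) x.2 / ε) := by
        fun_prop
      exact (c.continuous.comp (continuous_pt.comp h1)).mul h2
    · exact hψ.aestronglyMeasurable.comp_fst
  · refine Filter.Eventually.of_forall fun x => ?_
    simp only [Function.uncurry, norm_mul, norm_cis, mul_one]
    rw [mul_comm]
    exact mul_le_mul_of_nonneg_left (h _ _) (norm_nonneg _)

/-- The part of the phase depending on `y` is `-2π y·(p/(2πε) - ζ₁/2)`, where ζ₁ is the position
component of `ζ`. -/
theorem weyl_inner_integral {d : ℕ} {ε : ℝ} (hε : 0 < ε) (ψ : Config d → ℂ) (q p : Config d)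
    (ζ : Phase d) :
    ∫ y : Config d, cis (2 * Real.pi * inner ℝ (pt ((2 : ℝ)⁻¹ • (q + y)) p) ζ) *
      cis (inner ℝ (q - y) p / ε) * ψ y =
    cis (Real.pi * inner ℝ q ζ.ofLp.1 + 2 * Real.pi * inner ℝ p ζ.ofLp.2 + inner ℝ q p / ε) *
      FourierTransform.fourier ψ ((2 * Real.pi * ε)⁻¹ • p - (2 : ℝ)⁻¹ • ζ.ofLp.1) := by
  rw [fourier_eq_cis, ← integral_const_mul]
  congr 1
  funext y
  rw [← mul_assoc, ← cis_add, ← cis_add]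
  congr 2
  rw [inner_pt]
  simp only [inner_smul_left, inner_add_left, inner_sub_left, inner_sub_right, inner_smul_right,
    conj_trivial]
  field_simp
  ring

/-- Substituting `p = 2πε (k + ζ₁/2)` leaves the Fourier inversion integral for `ψ` at `q + 2πε ζ₂`.
The Jacobian is the factor that cancels the normalization of the quantization. -/
theorem weyl_outer_integral {d : ℕ} {ε : ℝ} (hε : 0 < ε) {ψ : Config d → ℂ} (hψ : Nice ψ)
    (q : Config d) (ζ : Phase d) :
    ∫ p : Config d,
      cis (Real.pi * inner ℝ q ζ.ofLp.1 + 2 * Real.pi * inner ℝ p ζ.ofLp.2 + inner ℝ q p / ε) *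
      FourierTransform.fourier ψ ((2 * Real.pi * ε)⁻¹ • p - (2 : ℝ)⁻¹ • ζ.ofLp.1) =
    ((2 * Real.pi * ε) ^ d : ℝ) * weylTrans ε ζ ψ q := by
  set K := 2 * Real.pi * ε with hK
  have hK0 : 0 < K := by positivity
  set G : Config d → ℂ := fun k =>
    cis (Real.pi * inner ℝ q ζ.ofLp.1 + 2 * Real.pi * (K * inner ℝ (k + (2 : ℝ)⁻¹ • ζ.ofLp.1) ζ.ofLp.2)
      + 2 * Real.pi * inner ℝ q (k + (2 : ℝ)⁻¹ • ζ.ofLp.1)) * FourierTransform.fourier ψ k with hG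
  have e1 : ∀ p : Config d,
      cis (Real.pi * inner ℝ q ζ.ofLp.1 + 2 * Real.pi * inner ℝ p ζ.ofLp.2 + inner ℝ q p / ε) *
      FourierTransform.fourier ψ (K⁻¹ • p - (2 : ℝ)⁻¹ • ζ.ofLp.1) =
      (fun k => G (k - (2 : ℝ)⁻¹ • ζ.ofLp.1)) (K⁻¹ • p) := by
    intro p
    simp only [hG, sub_add_cancel]
    congr 3
    · rw [inner_smul_left]; simp; field_simp
    · rw [inner_smul_right, hK]; field_simp
  simp_rw [e1]
  rw [Measure.integral_comp_inv_smul volume (fun k => G (k - (2 : ℝ)⁻¹ • ζ.ofLp.1)) K,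
    integral_sub_right_eq_self]
  simp only [finrank_euclideanSpace, Fintype.card_fin, Complex.real_smul]
  rw [abs_of_pos (by positivity)]
  congr 1
  rw [weylTrans, hψ.eq_integral, ← integral_const_mul]
  congr 1
  funext k
  simp only [hG]
  rw [← mul_assoc (cis _) (cis _), ← cis_add]
  congr 2
  simp only [inner_smul_left, inner_add_left, inner_add_right, inner_smul_right, conj_trivial]
  rw [real_inner_comm q ζ.ofLp.1, real_inner_comm q k, hK]
  ring

/-- Weyl quantization of a superposition of plane waves. -/
theorem weylFun_of_rep {d : ℕ} {V : Type*} [MeasurableSpace V] {μ : Measure V} [SFinite μ]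
    {ε : ℝ} (hε : 0 < ε) {F : V → ℂ} (hF : Integrable F μ) {L : V → Phase d} (hL : Measurable L)
    {c : 𝓢(Phase d, ℂ)} (hc : ∀ z, c z = ∫ v, F v * cis (2 * Real.pi * inner ℝ z (L v)) ∂μ)
    {ψ : Config d → ℂ} (hψ : Nice ψ) (q : Config d) :
    weylFun ε c ψ q = ∫ v, F v * weylTrans ε (L v) ψ q ∂μ := by
  set K := 2 * Real.pi * ε with hK
  have hK0 : 0 < K := by positivity
  have hL1 := measurable_ofLp_fst.comp hL
  have hL2 := measurable_ofLp_snd.comp hL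
  rw [weylFun_swap ε c hψ.int]
  have step1 : ∀ p : Config d, ∫ y : Config d,
      c (pt ((2 : ℝ)⁻¹ • (q + y)) p) * cis (inner ℝ (q - y) p / ε) * ψ y =
      ∫ v, F v * (cis (Real.pi * inner ℝ q (L v).ofLp.1 + 2 * Real.pi * inner ℝ p (L v).ofLp.2 +
        inner ℝ q p / ε) *
      FourierTransform.fourier ψ (K⁻¹ • p - (2 : ℝ)⁻¹ • (L v).ofLp.1)) ∂μ := by
    intro p
    simp_rw [hK, ← weyl_inner_integral hε ψ q p, ← integral_const_mul]
    -- Absolute convergence over `(y, v)` is immediate: all phases have modulus one, leaving `|F(v)|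
    -- |ψ(y)|`.
    rw [integral_integral_swap]
    · congr 1
      funext y
      rw [hc, mul_assoc, ← integral_mul_const]
      congr 1
      funext v
      ring
    · refine Integrable.mono' (hF.norm.mul_prod hψ.int.norm) ?_ ?_
      · refine hF.aestronglyMeasurable.comp_fst.mul ((AEStronglyMeasurable.mul ?_ ?_).mul
          hψ.int.aestronglyMeasurable.comp_snd)
        · refine (continuous_cis.measurable.comp (Measurable.const_mul (Measurable.inner ?_ ?_)
            _)).aestronglyMeasurable
          · exact (continuous_pt.comp (by fun_prop :
              Continuous fun x : Config d => ((2 : ℝ)⁻¹ • (q + x), p))).measurable.comp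
              measurable_snd
          · exact hL.comp measurable_fst
        · have h1 : Continuous fun y : Config d => cis (inner ℝ (q - y) p / ε) := by fun_prop
          exact (h1.measurable.comp measurable_snd).aestronglyMeasurable
      · refine Filter.Eventually.of_forall fun x => ?_
        simp [Function.uncurry]
  simp_rw [step1]
  rw [integral_integral_swap]
  · simp_rw [integral_const_mul, hK, weyl_outer_integral hε hψ]
    rw [← integral_const_mul]
    congr 1
    funext v
    have : ((K ^ d)⁻¹ : ℝ) * ((K ^ d : ℝ) : ℂ) = 1 := by
      rw [← Complex.ofReal_mul, inv_mul_cancel₀ (by positivity), Complex.ofReal_one]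
    rw [← hK]
    linear_combination (F v * weylTrans ε (L v) ψ q) * this
  · have hm : AEStronglyMeasurable (Function.uncurry fun (p : Config d) (v : V) =>
        F v * (cis (Real.pi * inner ℝ q (L v).ofLp.1 + 2 * Real.pi * inner ℝ p (L v).ofLp.2 +
        inner ℝ q p / ε) * FourierTransform.fourier ψ (K⁻¹ • p - (2 : ℝ)⁻¹ • (L v).ofLp.1)))
        ((volume : Measure (Config d)).prod μ) := by
      have hcont : Continuous (FourierTransform.fourier ψ) :=
        VectorFourier.fourierIntegral_continuous Real.continuous_fourierChar
          (by exact continuous_inner) hψ.int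
      refine hF.aestronglyMeasurable.comp_snd.mul (AEStronglyMeasurable.mul ?_ ?_)
      · refine (continuous_cis.measurable.comp ?_).aestronglyMeasurable
        have h1 : Measurable fun x : Config d × V => (L x.2).ofLp.1 := hL1.comp measurable_snd
        have h2 : Measurable fun x : Config d × V => (L x.2).ofLp.2 := hL2.comp measurable_snd
        fun_prop
      · refine (hcont.measurable.comp ?_).aestronglyMeasurable
        have h1 : Measurable fun x : Config d × V => (L x.2).ofLp.1 := hL1.comp measurable_snd
        fun_prop
    -- The shift of the Fourier transform depends on `v`, so there is no dominating product.
    -- Integrability is tested section by section, and translation invariance makes the integral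
    -- over `p` a constant times `‖F v‖`.
    rw [integrable_prod_iff' hm]
    have hs : ∀ u : Config d,
        Integrable fun p => FourierTransform.fourier ψ (K⁻¹ • p - u) := fun u =>
      (hψ.fint.comp_sub_right u).comp_smul (inv_ne_zero hK0.ne')
    constructor
    · refine Filter.Eventually.of_forall fun v => ?_
      simp only [Function.uncurry]
      refine Integrable.const_mul ?_ (F v)
      refine (hs ((2 : ℝ)⁻¹ • (L v).ofLp.1)).bdd_mul (c := 1) ?_ ?_
      · exact Continuous.aestronglyMeasurable (by fun_prop)
      · exact Filter.Eventually.of_forall fun x => by simp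
    · have : ∀ v, ∫ p : Config d, ‖Function.uncurry (fun (p : Config d) (v : V) =>
        F v * (cis (Real.pi * inner ℝ q (L v).ofLp.1 + 2 * Real.pi * inner ℝ p (L v).ofLp.2 +
        inner ℝ q p / ε) * FourierTransform.fourier ψ (K⁻¹ • p - (2 : ℝ)⁻¹ • (L v).ofLp.1)))
          (p, v)‖ = ‖F v‖ * (K ^ d * ∫ k, ‖FourierTransform.fourier ψ k‖) := by
        intro v
        simp only [Function.uncurry, norm_mul, norm_cis, one_mul]
        rw [integral_const_mul]
        congr 1
        have := Measure.integral_comp_inv_smul (volume : Measure (Config d))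
          (fun k => ‖FourierTransform.fourier ψ (k - (2 : ℝ)⁻¹ • (L v).ofLp.1)‖) K
        rw [this, integral_sub_right_eq_self fun k => ‖FourierTransform.fourier ψ k‖,
          abs_of_pos (by positivity)]
        simp
      simp_rw [this]
      exact hF.norm.mul_const _

/-! ### The operator norm bound by the total mass of the weight. -/

/-- Cauchy–Schwarz for the splitting `f g = f^{1/2} · (f^{1/2} g)`. Placing only one factor `f`
beside `g²` lets the mass of `f` come out squared after a further integration. -/
theorem lintegral_mul_sq_le {α : Type*} [MeasurableSpace α] {μ : Measure α} {f g : α → ENNReal}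
    (hf : AEMeasurable f μ) (hg : AEMeasurable g μ) :
    (∫⁻ v, f v * g v ∂μ) ^ 2 ≤ (∫⁻ v, f v ∂μ) * ∫⁻ v, f v * g v ^ 2 ∂μ := by
  have h := ENNReal.lintegral_mul_norm_pow_le (p := 1 / 2) (q := 1 / 2) hf
    (hf.mul (hg.pow_const 2)) (by norm_num) (by norm_num) (by norm_num)
  have hsq : ∀ t : ENNReal, (t ^ (1 / 2 : ℝ)) ^ 2 = t := fun t => by
    rw [← ENNReal.rpow_natCast, ← ENNReal.rpow_mul]; norm_num
  have hsq' : ∀ t : ENNReal, (t ^ 2) ^ (1 / 2 : ℝ) = t := fun t => by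
    rw [← ENNReal.rpow_natCast, ← ENNReal.rpow_mul]; norm_num
  have e : ∀ v, f v ^ (1 / 2 : ℝ) * ((f * fun v => g v ^ 2) v) ^ (1 / 2 : ℝ) = f v * g v := by
    intro v
    rw [Pi.mul_apply, ENNReal.mul_rpow_of_nonneg _ _ (by norm_num), hsq', ← mul_assoc, ← sq, hsq]
  simp only [e] at h
  calc _ ≤ _ := pow_le_pow_left' h 2
    _ = _ := by rw [mul_pow, hsq, hsq]; rfl

theorem measurable_weylTrans {d : ℕ} {V : Type*} [MeasurableSpace V] (ε : ℝ) {L : V → Phase d}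
    (hL : Measurable L) {ψ : Config d → ℂ} (hψ : Continuous ψ) :
    Measurable fun x : Config d × V => weylTrans ε (L x.2) ψ x.1 := by
  have h1 : Measurable fun x : Config d × V => (L x.2).ofLp.1 :=
    measurable_ofLp_fst.comp (hL.comp measurable_snd)
  have h2 : Measurable fun x : Config d × V => (L x.2).ofLp.2 :=
    measurable_ofLp_snd.comp (hL.comp measurable_snd)
  refine Measurable.mul (continuous_cis.measurable.comp (by fun_prop))
    (hψ.measurable.comp (by fun_prop))

theorem norm_weylTrans {d : ℕ} (ε : ℝ) (ζ : Phase d) (ψ : Config d → ℂ) (q : Config d) :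
    ‖weylTrans ε ζ ψ q‖ = ‖ψ (q + (2 * Real.pi * ε) • ζ.ofLp.2)‖ := by
  rw [weylTrans, norm_mul, norm_cis, one_mul]

/-- Superpositions of Weyl translations are bounded on `L²` by the total mass of the weight. -/
theorem lintegral_superposition_sq_le {d : ℕ} {V : Type*} [MeasurableSpace V] {μ : Measure V}
    [SFinite μ] (ε : ℝ) {F : V → ℂ} (hF : AEStronglyMeasurable F μ) {L : V → Phase d}
    (hL : Measurable L) {ψ : Config d → ℂ} (hψ : Continuous ψ) :
    ∫⁻ q, ‖∫ v, F v * weylTrans ε (L v) ψ q ∂μ‖ₑ ^ 2 ≤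
      (∫⁻ v, ‖F v‖ₑ ∂μ) ^ 2 * ∫⁻ q, ‖ψ q‖ₑ ^ 2 := by
  set M := ∫⁻ v, ‖F v‖ₑ ∂μ with hM
  have hw := measurable_weylTrans ε hL hψ
  have h1 : ∀ q, ‖∫ v, F v * weylTrans ε (L v) ψ q ∂μ‖ₑ ^ 2 ≤
      M * ∫⁻ v, ‖F v‖ₑ * ‖weylTrans ε (L v) ψ q‖ₑ ^ 2 ∂μ := by
    intro q
    refine le_trans (pow_le_pow_left' (enorm_integral_le_lintegral_enorm _) 2) ?_
    simp_rw [enorm_mul]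
    exact lintegral_mul_sq_le hF.enorm
      (hw.comp (measurable_const.prodMk measurable_id)).enorm.aemeasurable
  refine (lintegral_mono h1).trans ?_
  have hmeas : AEMeasurable (Function.uncurry fun (q : Config d) (v : V) =>
      ‖F v‖ₑ * ‖weylTrans ε (L v) ψ q‖ₑ ^ 2) ((volume : Measure (Config d)).prod μ) :=
    hF.comp_snd.enorm.mul (hw.enorm.pow_const 2).aemeasurable
  have hmeas' : AEMeasurable (fun q : Config d =>
      ∫⁻ v, ‖F v‖ₑ * ‖weylTrans ε (L v) ψ q‖ₑ ^ 2 ∂μ) := hmeas.lintegral_prod_right'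
  rw [lintegral_const_mul'' _ hmeas', lintegral_lintegral_swap hmeas, sq,
    mul_assoc]
  gcongr
  -- Each Weyl translation preserves the L² norm, since Lebesgue measure is translation invariant.
  have h2 : ∀ v, ∫⁻ q, ‖F v‖ₑ * ‖weylTrans ε (L v) ψ q‖ₑ ^ 2 = ‖F v‖ₑ * ∫⁻ q, ‖ψ q‖ₑ ^ 2 := by
    intro v
    have e : ∀ q, ‖weylTrans ε (L v) ψ q‖ₑ =
        ‖ψ (q + (2 * Real.pi * ε) • (L v).ofLp.2)‖ₑ := fun q => by
      rw [← ofReal_norm, norm_weylTrans, ofReal_norm]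
    simp_rw [e]
    rw [lintegral_const_mul' _ _ enorm_ne_top,
      lintegral_add_right_eq_self (fun q => ‖ψ q‖ₑ ^ 2)]
  simp_rw [h2]
  rw [lintegral_mul_const'' _ hF.enorm]

/-- The equality is everywhere, not almost everywhere, because `ψ` enters only under an integral.
Representatives of L² classes can thus be replaced before evaluating pointwise. -/
theorem weylFun_congr {d : ℕ} (ε : ℝ) (c : 𝓢(Phase d, ℂ)) {ψ φ : Config d → ℂ}
    (h : ψ =ᵐ[volume] φ) : weylFun ε c ψ = weylFun ε c φ := by
  funext q
  rw [weylFun_eq, weylFun_eq]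
  congr 1
  refine integral_congr_ae ?_
  filter_upwards [h] with y hy
  rw [hy]

theorem eLpNorm_two_sq {α : Type*} [MeasurableSpace α] (μ : Measure α) (f : α → ℂ) :
    eLpNorm f 2 μ ^ 2 = ∫⁻ q, ‖f q‖ₑ ^ 2 ∂μ := by
  have := eLpNorm_nnreal_pow_eq_lintegral (f := f) (μ := μ) (p := 2) two_ne_zero
  simpa using this

theorem eLpNorm_superposition_le {d : ℕ} {V : Type*} [MeasurableSpace V] {μ : Measure V}
    [SFinite μ] (ε : ℝ) {F : V → ℂ} (hF : Integrable F μ) {L : V → Phase d}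
    (hL : Measurable L) {ψ : Config d → ℂ} (hψ : Continuous ψ)
    (hψ2 : MemLp ψ 2) :
    (eLpNorm (fun q => ∫ v, F v * weylTrans ε (L v) ψ q ∂μ) 2 volume).toReal ≤
      (∫ v, ‖F v‖ ∂μ) * (eLpNorm ψ 2 volume).toReal := by
  have hM : ∫ v, ‖F v‖ ∂μ = (∫⁻ v, ‖F v‖ₑ ∂μ).toReal := integral_norm_eq_lintegral_enorm hF.1
  rw [hM, ← ENNReal.toReal_mul]
  refine ENNReal.toReal_mono (ENNReal.mul_ne_top hF.2.ne hψ2.2.ne) ?_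
  rw [← ENNReal.pow_le_pow_left_iff two_ne_zero, mul_pow, eLpNorm_two_sq, eLpNorm_two_sq]
  exact lintegral_superposition_sq_le ε hF.1 hL hψ

/-- The bound holds on Schwartz functions, where the wave representation is available pointwise, and
extends by density. The parameter space `V` is left general because the remainder is a superposition
over pairs of frequencies, with `L` their sum. -/
theorem norm_opWe_le {d : ℕ} {V : Type*} [MeasurableSpace V] {μ : Measure V} [SFinite μ]
    {ε : ℝ} (hε : 0 < ε) {F : V → ℂ} (hF : Integrable F μ) {L : V → Phase d} (hL : Measurable L)
    {c : 𝓢(Phase d, ℂ)} (hc : ∀ z, c z = ∫ v, F v * cis (2 * Real.pi * inner ℝ z (L v)) ∂μ) :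
    ‖opWe ε hε c‖ ≤ ∫ v, ‖F v‖ ∂μ := by
  have key : ∀ φ : 𝓢(Config d, ℂ),
      ‖opWe ε hε c (φ.toLp 2)‖ ≤ (∫ v, ‖F v‖ ∂μ) * ‖φ.toLp 2 (volume : Measure (Config d))‖ := by
    intro φ
    have e1 : opWe ε hε c (φ.toLp 2) =ᵐ[volume]
        fun q => ∫ v, F v * weylTrans ε (L v) φ q ∂μ := by
      filter_upwards [opWe_coeFn ε hε c (φ.toLp 2)] with q hq
      rw [hq, weylFun_congr ε c (φ.coeFn_toLp 2),
        weylFun_of_rep hε hF hL hc (nice_of_schwartz φ)]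
    rw [Lp.norm_def, Lp.norm_def, eLpNorm_congr_ae e1, eLpNorm_congr_ae (φ.coeFn_toLp 2 volume)]
    exact eLpNorm_superposition_le ε hF hL φ.continuous (φ.memLp 2)
  refine ContinuousLinearMap.opNorm_le_bound _ (integral_nonneg fun _ => norm_nonneg _) fun ψ => ?_
  have hd : DenseRange fun φ : 𝓢(Config d, ℂ) => φ.toLp 2 (volume : Measure (Config d)) :=
    SchwartzMap.denseRange_toLpCLM (by norm_num)
  have hcl : IsClosed {ψ : L2 d | ‖opWe ε hε c ψ‖ ≤ (∫ v, ‖F v‖ ∂μ) * ‖ψ‖} :=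
    isClosed_le (opWe ε hε c).continuous.norm (continuous_const.mul continuous_norm)
  exact hd.induction_on ψ hcl key

/-! ### Composition of Weyl operators. -/

theorem schwartz_rep {d : ℕ} (c : 𝓢(Phase d, ℂ)) (z : Phase d) :
    c z = ∫ ζ, FourierTransform.fourier c ζ * cis (2 * Real.pi * inner ℝ z ζ) := by
  conv_lhs => rw [← FourierTransform.fourierInv_fourier_eq (F := 𝓢(Phase d, ℂ)) c]
  rw [SchwartzMap.fourierInv_coe, fourierInv_eq_cis]
  congr 1
  funext ζ
  rw [mul_comm, real_inner_comm]

theorem weylFun_eq_superposition {d : ℕ} {ε : ℝ} (hε : 0 < ε) (c : 𝓢(Phase d, ℂ))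
    {ψ : Config d → ℂ} (hψ : Nice ψ) (q : Config d) :
    weylFun ε c ψ q = ∫ ζ, FourierTransform.fourier c ζ * weylTrans ε ζ ψ q :=
  weylFun_of_rep hε (FourierTransform.fourier c).integrable (L := fun ζ => ζ) measurable_id
    (schwartz_rep c) hψ q

theorem continuous_weylTrans {d : ℕ} (ε : ℝ) (ζ : Phase d) {ψ : Config d → ℂ}
    (hψ : Continuous ψ) : Continuous (weylTrans ε ζ ψ) :=
  Continuous.mul (by fun_prop) (hψ.comp (by fun_prop))

/-- On the Fourier side a Weyl translation is again a phase times a translation. Hence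
superpositions of them keep the Fourier transform integrable. -/
theorem fourier_weylTrans {d : ℕ} (ε : ℝ) (ζ : Phase d) (ψ : Config d → ℂ) (k : Config d) :
    FourierTransform.fourier (weylTrans ε ζ ψ) k =
      cis (2 * Real.pi * inner ℝ ζ.ofLp.2 ((2 * Real.pi * ε) • k - (Real.pi * ε) • ζ.ofLp.1)) *
        FourierTransform.fourier ψ (k - ζ.ofLp.1) := by
  rw [fourier_eq_cis, fourier_eq_cis, ← integral_const_mul,
    ← integral_sub_right_eq_self _ ((2 * Real.pi * ε) • ζ.ofLp.2)]
  congr 1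
  funext y
  rw [weylTrans, sub_add_cancel, ← mul_assoc, ← mul_assoc, ← cis_add, ← cis_add]
  congr 2
  simp only [inner_add_right, inner_sub_left, inner_sub_right, inner_smul_left, inner_smul_right,
    conj_trivial]
  rw [real_inner_comm y ζ.ofLp.1, real_inner_comm ζ.ofLp.2 ζ.ofLp.1]
  ring

/-- To compose two quantizations, the output of the first need not be shown Schwartz: Fourier
inversion suffices. Continuity comes from dominated convergence, integrability from the weighted
kernel bound, and integrability of the transform from writing it as a superposition of translates of
the transform of `ψ`. -/
theorem nice_weylFun {d : ℕ} {ε : ℝ} (hε : 0 < ε) (c : 𝓢(Phase d, ℂ)) (ψ : 𝓢(Config d, ℂ)) :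
    Nice (weylFun ε c ψ) := by
  have hψ := nice_of_schwartz ψ
  have e : weylFun ε c ψ = fun q => ∫ ζ, FourierTransform.fourier c ζ * weylTrans ε ζ ψ q :=
    funext fun q => weylFun_eq_superposition hε c hψ q
  have hF := (FourierTransform.fourier c).integrable (μ := volume)
  obtain ⟨C, hC⟩ : ∃ C, ∀ y, ‖ψ y‖ ≤ C :=
    ⟨_, fun y => SchwartzMap.norm_le_seminorm ℝ ψ y⟩
  have hcont : Continuous (weylFun ε c ψ) := by
    rw [e]
    refine continuous_of_dominated (F := fun q ζ => FourierTransform.fourier c ζ * weylTrans ε ζ ψ q)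
      (bound := fun ζ => ‖FourierTransform.fourier c ζ‖ * C) ?_ ?_ (hF.norm.mul_const C) ?_
    · intro q
      exact hF.aestronglyMeasurable.mul ((measurable_weylTrans ε measurable_id ψ.continuous).comp
        (measurable_const.prodMk measurable_id)).aestronglyMeasurable
    · intro q
      refine Filter.Eventually.of_forall fun ζ => ?_
      rw [norm_mul, norm_weylTrans]
      exact mul_le_mul_of_nonneg_left (hC _) (norm_nonneg _)
    · exact Filter.Eventually.of_forall fun ζ =>
        continuous_const.mul (continuous_weylTrans ε ζ ψ.continuous)
  refine ⟨hcont, ?_, ?_⟩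
  · obtain ⟨B, hB, hb⟩ := weylFun_bound hε c
    refine ((integrable_weight d).const_mul (B * ‖ψ.toLp 2 (volume : Measure (Config d))‖)).mono'
      hcont.aestronglyMeasurable (Filter.Eventually.of_forall fun q => ?_)
    have := hb (ψ.toLp 2) q
    rwa [weylFun_congr ε c (ψ.coeFn_toLp 2 volume), Real.norm_of_nonneg (by positivity)] at this
  · have hcf : Continuous (FourierTransform.fourier (ψ : Config d → ℂ)) := by
      rw [← SchwartzMap.fourier_coe]
      exact (FourierTransform.fourier ψ).continuous
    have e2 : FourierTransform.fourier (weylFun ε c ψ) = fun k =>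
        ∫ ζ, FourierTransform.fourier c ζ * (cis (2 * Real.pi * inner ℝ ζ.ofLp.2
          ((2 * Real.pi * ε) • k - (Real.pi * ε) • ζ.ofLp.1)) *
          FourierTransform.fourier (ψ : Config d → ℂ) (k - ζ.ofLp.1)) := by
      funext k
      simp_rw [← fourier_weylTrans, fourier_eq_cis (weylTrans _ _ _), ← integral_const_mul]
      rw [e, fourier_eq_cis]
      simp_rw [← integral_const_mul]
      rw [integral_integral_swap]
      · congr 1
        funext ζ
        congr 1
        funext q
        ring
      · have hm : Measurable (Function.uncurry fun (q : Config d) (ζ : Phase d) =>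
            cis (-(2 * Real.pi * inner ℝ q k)) *
              (FourierTransform.fourier c ζ * weylTrans ε ζ ψ q)) := by
          refine Measurable.mul ?_ (Measurable.mul ?_
            (measurable_weylTrans ε measurable_id ψ.continuous))
          · have h1 : Continuous fun q : Config d => cis (-(2 * Real.pi * inner ℝ q k)) := by
              fun_prop
            exact h1.measurable.comp measurable_fst
          · exact (FourierTransform.fourier c).continuous.measurable.comp measurable_snd
        have hn : ∀ (q : Config d) (ζ : Phase d), ‖cis (-(2 * Real.pi * inner ℝ q k)) *
              (FourierTransform.fourier c ζ * weylTrans ε ζ ψ q)‖ =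
            ‖FourierTransform.fourier c ζ‖ * ‖ψ (q + (2 * Real.pi * ε) • ζ.ofLp.2)‖ := by
          intro q ζ
          rw [norm_mul, norm_mul, norm_cis, one_mul, norm_weylTrans]
        rw [integrable_prod_iff' hm.aestronglyMeasurable]
        constructor
        · refine Filter.Eventually.of_forall fun ζ => ?_
          refine (((hψ.int.comp_add_right ((2 * Real.pi * ε) • ζ.ofLp.2)).norm).const_mul
            ‖FourierTransform.fourier c ζ‖).mono'
            (hm.comp (measurable_id.prodMk measurable_const)).aestronglyMeasurable
            (Filter.Eventually.of_forall fun q => (hn q ζ).le)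
        · simp only [Function.uncurry, hn]
          simp_rw [integral_const_mul]
          have : ∀ ζ : Phase d, ∫ q : Config d, ‖ψ (q + (2 * Real.pi * ε) • ζ.ofLp.2)‖ =
              ∫ q, ‖ψ q‖ := fun ζ => integral_add_right_eq_self (fun q => ‖ψ q‖) _
          simp_rw [this]
          exact hF.norm.mul_const _
    rw [e2]
    have hm : Measurable (fun x : Config d × Phase d => FourierTransform.fourier c x.2 *
        (cis (2 * Real.pi * inner ℝ x.2.ofLp.2
          ((2 * Real.pi * ε) • x.1 - (Real.pi * ε) • x.2.ofLp.1)) *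
          FourierTransform.fourier (ψ : Config d → ℂ) (x.1 - x.2.ofLp.1))) := by
      have h1 : Measurable fun x : Config d × Phase d => x.2.ofLp.1 :=
        measurable_ofLp_fst.comp measurable_snd
      have h2 : Measurable fun x : Config d × Phase d => x.2.ofLp.2 :=
        measurable_ofLp_snd.comp measurable_snd
      exact ((FourierTransform.fourier c).continuous.measurable.comp measurable_snd).mul
        ((continuous_cis.measurable.comp (by fun_prop)).mul (hcf.measurable.comp (by fun_prop)))
    have hn : ∀ (k : Config d) (ζ : Phase d), ‖FourierTransform.fourier c ζ *
        (cis (2 * Real.pi * inner ℝ ζ.ofLp.2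
          ((2 * Real.pi * ε) • k - (Real.pi * ε) • ζ.ofLp.1)) *
          FourierTransform.fourier (ψ : Config d → ℂ) (k - ζ.ofLp.1))‖ =
        ‖FourierTransform.fourier c ζ‖ *
          ‖FourierTransform.fourier (ψ : Config d → ℂ) (k - ζ.ofLp.1)‖ := by
      intro k ζ
      rw [norm_mul, norm_mul, norm_cis, one_mul]
    refine Integrable.integral_prod_left (μ := (volume : Measure (Config d)))
      (ν := (volume : Measure (Phase d))) (f := fun x : Config d × Phase d =>
        FourierTransform.fourier c x.2 * (cis (2 * Real.pi * inner ℝ x.2.ofLp.2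
          ((2 * Real.pi * ε) • x.1 - (Real.pi * ε) • x.2.ofLp.1)) *
          FourierTransform.fourier (ψ : Config d → ℂ) (x.1 - x.2.ofLp.1))) ?_
    rw [integrable_prod_iff' hm.aestronglyMeasurable]
    constructor
    · refine Filter.Eventually.of_forall fun ζ => ?_
      refine (((hψ.fint.comp_sub_right ζ.ofLp.1).norm).const_mul
        ‖FourierTransform.fourier c ζ‖).mono'
        (hm.comp (measurable_id.prodMk measurable_const)).aestronglyMeasurable
        (Filter.Eventually.of_forall fun k => (hn k ζ).le)
    · simp only [hn]
      simp_rw [integral_const_mul]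
      have : ∀ ζ : Phase d,
          ∫ k : Config d, ‖FourierTransform.fourier (ψ : Config d → ℂ) (k - ζ.ofLp.1)‖ =
          ∫ k, ‖FourierTransform.fourier (ψ : Config d → ℂ) k‖ := fun ζ =>
        integral_sub_right_eq_self (fun k => ‖FourierTransform.fourier (ψ : Config d → ℂ) k‖) _
      simp_rw [this]
      exact hF.norm.mul_const _

/-- The symplectic form `(Jζ, ω)`. -/
def sympl {d : ℕ} (ζ ω : Phase d) : ℝ :=
  inner ℝ ζ.ofLp.2 ω.ofLp.1 - inner ℝ ζ.ofLp.1 ω.ofLp.2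

/-- The translations commute only up to a phase. The cross terms of the two position phases are
halved symmetrically, leaving the antisymmetric form. -/
theorem weylTrans_weylTrans {d : ℕ} (ε : ℝ) (ζ ω : Phase d) (ψ : Config d → ℂ) (q : Config d) :
    weylTrans ε ζ (weylTrans ε ω ψ) q =
      cis (2 * Real.pi ^ 2 * ε * sympl ζ ω) * weylTrans ε (ζ + ω) ψ q := by
  simp only [weylTrans]
  rw [← mul_assoc, ← mul_assoc, ← cis_add, ← cis_add]
  congr 2
  · simp only [sympl, WithLp.ofLp_add, Prod.fst_add, Prod.snd_add, inner_add_left,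
      inner_add_right, inner_smul_right]
    rw [real_inner_comm ω.ofLp.1 ζ.ofLp.2]
    ring
  · rw [WithLp.ofLp_add, Prod.snd_add, smul_add, add_assoc]

theorem continuous_sympl {d : ℕ} : Continuous fun v : Phase d × Phase d => sympl v.1 v.2 := by
  unfold sympl
  fun_prop

theorem measurable_add_phase {d : ℕ} : Measurable fun v : Phase d × Phase d => v.1 + v.2 :=
  measurable_fst.add measurable_snd

theorem integrable_twisted {d : ℕ} (ε : ℝ) (f g : 𝓢(Phase d, ℂ)) :
    Integrable (fun v : Phase d × Phase d => f v.1 * g v.2 *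
      cis (2 * Real.pi ^ 2 * ε * sympl v.1 v.2)) (volume.prod volume) := by
  refine ((f.integrable (μ := volume)).mul_prod (g.integrable (μ := volume))).mul_bdd (c := 1) ?_ ?_
  · exact (continuous_cis.comp (continuous_const.mul continuous_sympl)).aestronglyMeasurable
  · exact Filter.Eventually.of_forall fun v => (norm_cis _).le

theorem weylFun_weylFun {d : ℕ} {ε : ℝ} (hε : 0 < ε) (f g : 𝓢(Phase d, ℂ))
    (ψ : 𝓢(Config d, ℂ)) (q : Config d) :
    weylFun ε f (weylFun ε g ψ) q =
      ∫ v : Phase d × Phase d, (FourierTransform.fourier f v.1 * FourierTransform.fourier g v.2 *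
        cis (2 * Real.pi ^ 2 * ε * sympl v.1 v.2)) * weylTrans ε (v.1 + v.2) ψ q
        ∂(volume.prod volume) := by
  rw [weylFun_eq_superposition hε f (nice_weylFun hε g ψ), integral_prod]
  · congr 1
    funext ζ
    conv_lhs => rw [weylTrans, weylFun_eq_superposition hε g (nice_of_schwartz ψ),
      ← integral_const_mul, ← integral_const_mul]
    congr 1
    funext ω
    have := weylTrans_weylTrans ε ζ ω ψ q
    rw [weylTrans] at this
    linear_combination (FourierTransform.fourier f ζ * FourierTransform.fourier g ω) * this
  · refine (integrable_twisted ε (FourierTransform.fourier f) (FourierTransform.fourier g)).mul_bdd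
      (c := SchwartzMap.seminorm ℝ 0 0 ψ) ?_ ?_
    · exact ((measurable_weylTrans ε measurable_add_phase ψ.continuous).comp
        (measurable_const.prodMk measurable_id)).aestronglyMeasurable
    · refine Filter.Eventually.of_forall fun v => ?_
      rw [norm_weylTrans]
      exact SchwartzMap.norm_le_seminorm ℝ ψ _

theorem clm_ext_schwartz {d : ℕ} {A B : L2 d →L[ℂ] L2 d}
    (h : ∀ φ : 𝓢(Config d, ℂ), A (φ.toLp 2 volume) = B (φ.toLp 2 volume)) : A = B := by
  have hd : DenseRange fun φ : 𝓢(Config d, ℂ) => φ.toLp 2 (volume : Measure (Config d)) :=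
    SchwartzMap.denseRange_toLpCLM (by norm_num)
  have hcl : IsClosed {ψ : L2 d | A ψ = B ψ} := isClosed_eq A.continuous B.continuous
  exact ContinuousLinearMap.ext fun ψ => hd.induction_on ψ hcl h

theorem opWe_opWe_coeFn {d : ℕ} {ε : ℝ} (hε : 0 < ε) (f g : 𝓢(Phase d, ℂ))
    (φ : 𝓢(Config d, ℂ)) :
    opWe ε hε f (opWe ε hε g (φ.toLp 2 volume)) =ᵐ[volume] weylFun ε f (weylFun ε g φ) := by
  have e1 : weylFun ε f (opWe ε hε g (φ.toLp 2 volume)) = weylFun ε f (weylFun ε g φ) := by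
    rw [weylFun_congr ε f (opWe_coeFn ε hε g (φ.toLp 2 volume)), weylFun_congr ε g (φ.coeFn_toLp 2 volume)]
  rw [← e1]
  exact opWe_coeFn ε hε f _

theorem opWe_coeFn_schwartz {d : ℕ} {ε : ℝ} (hε : 0 < ε) (c : 𝓢(Phase d, ℂ))
    (φ : 𝓢(Config d, ℂ)) : opWe ε hε c (φ.toLp 2 volume) =ᵐ[volume] weylFun ε c φ := by
  rw [← weylFun_congr ε c (φ.coeFn_toLp 2 volume)]
  exact opWe_coeFn ε hε c _

/-- Two Schwartz symbols compose to a third one if the latter is the twisted superposition. -/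
theorem opWe_comp {d : ℕ} {ε : ℝ} (hε : 0 < ε) {f g c : 𝓢(Phase d, ℂ)}
    (hc : ∀ z, c z = ∫ v : Phase d × Phase d,
      (FourierTransform.fourier f v.1 * FourierTransform.fourier g v.2 *
        cis (2 * Real.pi ^ 2 * ε * sympl v.1 v.2)) * cis (2 * Real.pi * inner ℝ z (v.1 + v.2))
        ∂(volume.prod volume)) :
    opWe ε hε f ∘L opWe ε hε g = opWe ε hε c := by
  refine clm_ext_schwartz fun φ => ?_
  have e : weylFun ε f (weylFun ε g φ) = weylFun ε c φ := funext fun q => by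
    rw [weylFun_weylFun hε, weylFun_of_rep hε (integrable_twisted ε _ _) measurable_add_phase hc
      (nice_of_schwartz φ)]
  have h1 := opWe_opWe_coeFn hε f g φ
  rw [e] at h1
  exact Lp.ext (h1.trans (opWe_coeFn_schwartz hε c φ).symm)

/-! ### The Moyal product as a Schwartz function. -/

theorem iteratedDeriv_cis (n : ℕ) : iteratedDeriv n cis = fun t => Complex.I ^ n * cis t := by
  induction n with
  | zero => simp
  | succ n ih =>
    rw [iteratedDeriv_succ, ih]
    funext t
    have h : HasDerivAt cis (Complex.I * cis t) t := by
      have := ((Complex.ofRealCLM.hasDerivAt (x := t)).mul_const Complex.I).cexp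
      rw [mul_comm]
      simpa using! this
    rw [(h.const_mul _).deriv]
    ring

theorem hasTemperateGrowth_cis : Function.HasTemperateGrowth cis := by
  refine ⟨?_, fun n => ⟨0, 1, fun x => ?_⟩⟩
  · exact (Complex.ofRealCLM.contDiff.mul contDiff_const).cexp
  · rw [norm_iteratedFDeriv_eq_norm_iteratedDeriv, iteratedDeriv_cis]
    simp

/-- The doubled phase space with its Euclidean structure. -/
abbrev Phase2 (d : ℕ) : Type := WithLp 2 (Phase d × Phase d)

theorem sympl_hasTemperateGrowth (d : ℕ) :
    Function.HasTemperateGrowth fun v : Phase2 d => sympl v.ofLp.1 v.ofLp.2 := by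
  have h1 : Function.HasTemperateGrowth fun v : Phase2 d => v.ofLp.1.ofLp.1 :=
    (WithLp.fstL 2 ℝ (Config d) (Config d) ∘L WithLp.fstL 2 ℝ (Phase d) (Phase d)).hasTemperateGrowth
  have h2 : Function.HasTemperateGrowth fun v : Phase2 d => v.ofLp.1.ofLp.2 :=
    (WithLp.sndL 2 ℝ (Config d) (Config d) ∘L WithLp.fstL 2 ℝ (Phase d) (Phase d)).hasTemperateGrowth
  have h3 : Function.HasTemperateGrowth fun v : Phase2 d => v.ofLp.2.ofLp.1 :=
    (WithLp.fstL 2 ℝ (Config d) (Config d) ∘L WithLp.sndL 2 ℝ (Phase d) (Phase d)).hasTemperateGrowth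
  have h4 : Function.HasTemperateGrowth fun v : Phase2 d => v.ofLp.2.ofLp.2 :=
    (WithLp.sndL 2 ℝ (Config d) (Config d) ∘L WithLp.sndL 2 ℝ (Phase d) (Phase d)).hasTemperateGrowth
  exact ((innerSL ℝ).bilinear_hasTemperateGrowth h2 h3).sub
    ((innerSL ℝ).bilinear_hasTemperateGrowth h1 h4)

/-- The diagonal embedding of phase space. -/
def diagL (d : ℕ) : Phase d →L[ℝ] Phase2 d :=
  (WithLp.prodContinuousLinearEquiv 2 ℝ (Phase d) (Phase d)).symm.toContinuousLinearMap ∘L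
    (ContinuousLinearMap.id ℝ (Phase d)).prod (ContinuousLinearMap.id ℝ (Phase d))

theorem inner_diagL {d : ℕ} (v : Phase2 d) (z : Phase d) :
    inner ℝ v (diagL d z) = inner ℝ z (v.ofLp.1 + v.ofLp.2) := by
  rw [WithLp.prod_inner_apply, inner_add_right, real_inner_comm v.ofLp.1,
    real_inner_comm v.ofLp.2]
  rfl

/-- The Moyal product exists as a Schwartz function. -/
theorem exists_moyal {d : ℕ} (ε : ℝ) (f g : 𝓢(Phase d, ℂ)) :
    ∃ c : 𝓢(Phase d, ℂ), ∀ z, c z = ∫ v : Phase d × Phase d,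
      (f v.1 * g v.2 * cis (2 * Real.pi ^ 2 * ε * sympl v.1 v.2)) *
        cis (2 * Real.pi * inner ℝ z (v.1 + v.2)) ∂(volume.prod volume) := by
  -- The twisted phase is bounded with polynomially bounded derivatives, so multiplying the tensor
  -- product by it stays Schwartz. The desired symbol is the inverse Fourier transform of the result
  -- restricted to the diagonal, as `(z, z)` pairs with a frequency pair to `z·(ζ+ω)`. The Euclidean
  -- norm on the doubled space is needed to have that transform.
  have hm : Function.HasTemperateGrowth fun v : Phase2 d =>
      cis (2 * Real.pi ^ 2 * ε * sympl v.ofLp.1 v.ofLp.2) :=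
    hasTemperateGrowth_cis.comp
      ((Function.HasTemperateGrowth.const _).mul (sympl_hasTemperateGrowth d))
  set H : 𝓢(Phase2 d, ℂ) := SchwartzMap.smulLeftCLM ℂ
    (fun v : Phase2 d => cis (2 * Real.pi ^ 2 * ε * sympl v.ofLp.1 v.ofLp.2))
    (SchwartzMap.compCLMOfContinuousLinearEquiv ℂ
      (WithLp.prodContinuousLinearEquiv 2 ℝ (Phase d) (Phase d)) (tensor f g)) with hH
  have hHv : ∀ v : Phase2 d, H v = f v.ofLp.1 * g v.ofLp.2 *
      cis (2 * Real.pi ^ 2 * ε * sympl v.ofLp.1 v.ofLp.2) := by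
    intro v
    rw [hH, SchwartzMap.smulLeftCLM_apply_apply hm, smul_eq_mul, mul_comm]
    rfl
  have hb : ∃ (k : ℕ) (C : ℝ), ∀ z, ‖z‖ ≤ C * (1 + ‖diagL d z‖) ^ k := by
    refine ⟨1, 1, fun z => ?_⟩
    have : ‖z‖ ≤ ‖diagL d z‖ := by
      rw [WithLp.prod_norm_eq_of_L2 (diagL d z)]
      refine Real.le_sqrt_of_sq_le ?_
      simp [diagL]
    linarith
  refine ⟨SchwartzMap.compCLM ℂ (diagL d).hasTemperateGrowth hb
    (FourierTransformInv.fourierInv H), fun z => ?_⟩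
  rw [SchwartzMap.compCLM_apply, Function.comp_apply, SchwartzMap.fourierInv_coe,
    fourierInv_eq_cis, ← Measure.volume_eq_prod,
    ← (WithLp.volume_preserving_ofLp (Phase d) (Phase d)).integral_comp
      (MeasurableEquiv.toLp 2 (Phase d × Phase d)).symm.measurableEmbedding]
  congr 1
  funext v
  rw [hHv, inner_diagL, mul_comm]

/-! ### Linearity in the symbol. -/

theorem weylFun_add_smul {d : ℕ} {ε : ℝ} (hε : 0 < ε) (c₁ c₂ : 𝓢(Phase d, ℂ)) (r : ℂ)
    (ψ : L2 d) (q : Config d) :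
    weylFun ε (c₁ + r • c₂) ψ q = weylFun ε c₁ ψ q + r * weylFun ε c₂ ψ q := by
  have hk : ∀ y, weylKer ε (c₁ + r • c₂) q y = weylKer ε c₁ q y + r * weylKer ε c₂ q y := by
    intro y
    have hs : ∀ x, slice (c₁ + r • c₂) x = slice c₁ x + r • slice c₂ x := fun x => rfl
    simp only [weylKer_eq_fourier hε, hs, FourierTransform.fourier_add,
      FourierTransform.fourier_smul]
    rfl
  have he : ∀ y, (weylKer ε c₁ q y + r * weylKer ε c₂ q y) * ψ y =
      weylKer ε c₁ q y * ψ y + r * (weylKer ε c₂ q y * ψ y) := fun y => by ring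
  simp only [weylFun_eq, hk, he]
  rw [integral_add (weylKer_integrable hε c₁ ψ q) ((weylKer_integrable hε c₂ ψ q).const_mul r),
    integral_const_mul]
  ring

theorem opWe_add_smul {d : ℕ} {ε : ℝ} (hε : 0 < ε) (c₁ c₂ : 𝓢(Phase d, ℂ)) (r : ℂ) :
    opWe ε hε (c₁ + r • c₂) = opWe ε hε c₁ + r • opWe ε hε c₂ := by
  refine ContinuousLinearMap.ext fun ψ => Lp.ext ?_
  rw [add_apply, smul_apply]
  filter_upwards [opWe_coeFn ε hε (c₁ + r • c₂) ψ, opWe_coeFn ε hε c₁ ψ, opWe_coeFn ε hε c₂ ψ,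
    Lp.coeFn_add (opWe ε hε c₁ ψ) (r • opWe ε hε c₂ ψ), Lp.coeFn_smul r (opWe ε hε c₂ ψ)]
    with q h h1 h2 h3 h4
  rw [h, h3, Pi.add_apply, h4, Pi.smul_apply, h1, h2, smul_eq_mul, weylFun_add_smul hε]

/-! ### The Taylor remainder of the complex exponential. -/

/-- Taylor's formula for the exponential, with a remainder governed by the real part. -/
theorem norm_exp_sub_sum_le_max (k : ℕ) (w : ℂ) :
    ‖Complex.exp w - ∑ m ∈ Finset.range k, w ^ m / (m.factorial : ℂ)‖ ≤
      ‖w‖ ^ k * max 1 (Real.exp w.re) := by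
  induction k generalizing w with
  | zero => simp [Complex.norm_exp]
  | succ k ih =>
    -- This is the remainder along the segment from 0 to `w`; its derivative is `w` times the
    -- remainder of one order less, so the mean value inequality closes the induction.
    set g : ℝ → ℂ := fun t => Complex.exp (t * w) -
      ∑ m ∈ Finset.range (k + 1), ((t : ℂ) * w) ^ m / (m.factorial : ℂ) with hg
    have hd : ∀ t : ℝ, HasDerivAt g (w * (Complex.exp (t * w) -
        ∑ m ∈ Finset.range k, ((t : ℂ) * w) ^ m / (m.factorial : ℂ))) t := by
      intro t
      have h0 : HasDerivAt (fun t : ℝ => (t : ℂ) * w) w t := by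
        simpa using! (Complex.ofRealCLM.hasDerivAt (x := t)).mul_const w
      have h1 := HasDerivAt.fun_sum (u := Finset.range (k + 1)) fun m _ =>
        (h0.fun_pow m).div_const (m.factorial : ℂ)
      refine (h0.cexp.sub h1).congr_deriv ?_
      symm
      rw [Finset.sum_range_succ', mul_sub, mul_comm w (Complex.exp _), Finset.mul_sum]
      simp only [Nat.cast_zero, zero_mul, zero_div, add_zero]
      congr 1
      refine Finset.sum_congr rfl fun m _ => ?_
      rw [Nat.factorial_succ, Nat.add_sub_cancel]
      have : (m.factorial : ℂ) ≠ 0 := by exact_mod_cast m.factorial_ne_zero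
      have h2 : ((m : ℂ) + 1) ≠ 0 := by exact_mod_cast m.succ_ne_zero
      push_cast
      field_simp
    have hb : ∀ t ∈ Set.Ico (0 : ℝ) 1, ‖w * (Complex.exp (t * w) -
        ∑ m ∈ Finset.range k, ((t : ℂ) * w) ^ m / (m.factorial : ℂ))‖ ≤
        ‖w‖ ^ (k + 1) * max 1 (Real.exp w.re) := by
      rintro t ⟨ht0, ht1⟩
      rw [norm_mul, pow_succ', mul_assoc]
      refine mul_le_mul_of_nonneg_left ((ih _).trans ?_) (norm_nonneg _)
      rw [norm_mul, Complex.norm_real, Real.norm_of_nonneg ht0, Complex.re_ofReal_mul]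
      refine mul_le_mul ?_ ?_ (by positivity) (by positivity)
      · exact pow_le_pow_left₀ (by positivity) (mul_le_of_le_one_left (norm_nonneg _) ht1.le) _
      · refine max_le (le_max_left _ _) ?_
        rcases le_total w.re 0 with h | h
        · exact (Real.exp_le_one_iff.2 (mul_nonpos_of_nonneg_of_nonpos ht0 h)).trans
            (le_max_left _ _)
        · exact (Real.exp_le_exp.2 (mul_le_of_le_one_left h ht1.le)).trans (le_max_right _ _)
    have := norm_image_sub_le_of_norm_deriv_le_segment_01'
      (fun t _ => (hd t).hasDerivWithinAt) hb
    have hg0 : g 0 = 0 := by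
      simp [hg, Finset.sum_range_succ']
    have hg1 : g 1 = Complex.exp w -
        ∑ m ∈ Finset.range (k + 1), w ^ m / (m.factorial : ℂ) := by
      simp [hg]
    rwa [hg0, hg1, sub_zero] at this

/-! ### Gaussian smoothing acts diagonally on waves. -/

theorem integral_cis_gaussian {d : ℕ} {ε : ℝ} (hε : 0 < ε) (z η : Phase d) :
    ∫ ζ : Phase d, cis (2 * Real.pi * inner ℝ ζ η) *
      ((((Real.pi * ε) ^ d)⁻¹ * Real.exp (-‖z - ζ‖ ^ 2 / ε) : ℝ) : ℂ) =
    (Real.exp (-(Real.pi ^ 2 * ε * ‖η‖ ^ 2)) : ℝ) * cis (2 * Real.pi * inner ℝ z η) := by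
  have := FiniteDimensional.proper ℝ (Phase d)
  rw [← integral_sub_left_eq_self (fun ζ : Phase d => cis (2 * Real.pi * inner ℝ ζ η) *
      ((((Real.pi * ε) ^ d)⁻¹ * Real.exp (-‖z - ζ‖ ^ 2 / ε) : ℝ) : ℂ)) volume z]
  simp only [sub_sub_cancel]
  have hF := fourier_gaussian_innerProductSpace (V := Phase d) (b := (ε⁻¹ : ℝ))
    (by simpa using hε) η
  rw [fourier_eq_cis] at hF
  have hdim : Module.finrank ℝ (Phase d) = 2 * d := by
    rw [(WithLp.linearEquiv 2 ℝ (Config d × Config d)).finrank_eq, Module.finrank_prod]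
    simp [two_mul]
  have hne : ((Real.pi * ε : ℝ) : ℂ) ≠ 0 := by
    exact_mod_cast (mul_pos Real.pi_pos hε).ne'
  -- Phase space has dimension `2d`, so the half-dimension power is an honest `d`-th power and
  -- cancels the normalization of the Gaussian.
  have hc : ((Real.pi : ℂ) / ((ε⁻¹ : ℝ) : ℂ)) ^ ((Module.finrank ℝ (Phase d) : ℂ) / 2) =
      ((Real.pi * ε : ℝ) : ℂ) ^ d := by
    rw [hdim]
    push_cast
    rw [mul_div_cancel_left₀ _ two_ne_zero, Complex.cpow_natCast, div_inv_eq_mul]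
  rw [hc] at hF
  have e : ∀ u : Phase d, cis (2 * Real.pi * inner ℝ (z - u) η) *
      ((((Real.pi * ε) ^ d)⁻¹ * Real.exp (-‖u‖ ^ 2 / ε) : ℝ) : ℂ) =
      (cis (2 * Real.pi * inner ℝ z η) * (((Real.pi * ε : ℝ) : ℂ) ^ d)⁻¹) *
      (cis (-(2 * Real.pi * inner ℝ u η)) * Complex.exp (-((ε⁻¹ : ℝ) : ℂ) * (‖u‖ : ℂ) ^ 2)) := by
    intro u
    have h1 : cis (2 * Real.pi * inner ℝ (z - u) η) =
        cis (2 * Real.pi * inner ℝ z η) * cis (-(2 * Real.pi * inner ℝ u η)) := by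
      rw [← cis_add, inner_sub_left]
      ring_nf
    have h2 : ((Real.exp (-‖u‖ ^ 2 / ε) : ℝ) : ℂ) =
        Complex.exp (-((ε⁻¹ : ℝ) : ℂ) * (‖u‖ : ℂ) ^ 2) := by
      push_cast
      congr 1
      ring
    rw [h1, Complex.ofReal_mul, h2]
    push_cast
    ring
  simp_rw [e]
  rw [integral_const_mul, hF]
  have h3 : Complex.exp (-(Real.pi : ℂ) ^ 2 * (‖η‖ : ℂ) ^ 2 / ((ε⁻¹ : ℝ) : ℂ)) =
      ((Real.exp (-(Real.pi ^ 2 * ε * ‖η‖ ^ 2)) : ℝ) : ℂ) := by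
    push_cast
    congr 1
    rw [div_inv_eq_mul]
    ring
  rw [h3]
  have h4 := inv_mul_cancel₀ (pow_ne_zero d hne)
  linear_combination (cis (2 * Real.pi * inner ℝ z η) *
    ((Real.exp (-(Real.pi ^ 2 * ε * ‖η‖ ^ 2)) : ℝ) : ℂ)) * h4

/-- Stated for an arbitrary parameter space because the expanded symbol is represented by pairs of
frequencies, not by its own Fourier transform. -/
theorem gaussConv_of_rep {d : ℕ} {V : Type*} [MeasurableSpace V] {μ : Measure V} [SFinite μ]
    {ε : ℝ} (hε : 0 < ε) {F : V → ℂ} (hF : Integrable F μ) {L : V → Phase d} (hL : Measurable L)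
    {c : 𝓢(Phase d, ℂ)} (hc : ∀ z, c z = ∫ v, F v * cis (2 * Real.pi * inner ℝ z (L v)) ∂μ)
    (z : Phase d) :
    gaussConv ε hε c z = ∫ v, F v * (Real.exp (-(Real.pi ^ 2 * ε * ‖L v‖ ^ 2)) : ℝ) *
      cis (2 * Real.pi * inner ℝ z (L v)) ∂μ := by
  rw [gaussConv_apply]
  have e1 : ∀ ζ : Phase d,
      c ζ * ((((Real.pi * ε) ^ d)⁻¹ * Real.exp (-‖z - ζ‖ ^ 2 / ε) : ℝ) : ℂ) =
      ∫ v, F v * cis (2 * Real.pi * inner ℝ ζ (L v)) *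
        ((((Real.pi * ε) ^ d)⁻¹ * Real.exp (-‖z - ζ‖ ^ 2 / ε) : ℝ) : ℂ) ∂μ := fun ζ => by
    rw [hc, integral_mul_const]
  have e2 : ∀ v, F v * (Real.exp (-(Real.pi ^ 2 * ε * ‖L v‖ ^ 2)) : ℝ) *
      cis (2 * Real.pi * inner ℝ z (L v)) =
      ∫ ζ : Phase d, F v * cis (2 * Real.pi * inner ℝ ζ (L v)) *
        ((((Real.pi * ε) ^ d)⁻¹ * Real.exp (-‖z - ζ‖ ^ 2 / ε) : ℝ) : ℂ) := fun v => by
    simp only [mul_assoc (F v)]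
    rw [integral_const_mul, integral_cis_gaussian hε]
  rw [integral_congr_ae (Filter.Eventually.of_forall e1),
    integral_congr_ae (Filter.Eventually.of_forall e2), integral_integral_swap]
  · have := FiniteDimensional.proper ℝ (Phase d)
    have hG : Integrable fun ζ : Phase d =>
        ((Real.pi * ε) ^ d)⁻¹ * Real.exp (-‖z - ζ‖ ^ 2 / ε) :=
      ((gaussian d ε hε).integrable (μ := volume)).comp_sub_left z
    refine (hG.norm.mul_prod hF.norm).mono' ?_ (Filter.Eventually.of_forall fun x => ?_)
    · refine AEStronglyMeasurable.mul (hF.aestronglyMeasurable.comp_snd.mul ?_) ?_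
      · refine (continuous_cis.measurable.comp (Measurable.const_mul (Measurable.inner
          measurable_fst (hL.comp measurable_snd)) _)).aestronglyMeasurable
      · exact (Complex.continuous_ofReal.comp_aestronglyMeasurable hG.aestronglyMeasurable).comp_fst
    · simp only [Function.uncurry, norm_mul, norm_cis, mul_one, Complex.norm_real]
      rw [mul_comm]

/-! ### The bidifferential operator on superpositions of waves. -/

/-- The value of `(∇_z,∇_w) + i (J∇_z,∇_w)` on the wave `(z, w) ↦ e^{2πi(z·ζ + w·ω)}`. -/
def waveSymbol {d : ℕ} (v : Phase d × Phase d) : ℂ :=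
  -(4 * (Real.pi : ℂ) ^ 2) *
    ((inner ℝ v.1 v.2 : ℝ) + Complex.I * (sympl v.1 v.2 : ℝ))

/-- `G` is the superposition of waves with integrable weight `H`. -/
def IsSuperposition {d : ℕ} (G : 𝓢(Phase d × Phase d, ℂ)) (H : Phase d × Phase d → ℂ) : Prop :=
  Integrable H (volume.prod volume) ∧ ∀ x, G x = ∫ v : Phase d × Phase d,
    H v * cis (2 * Real.pi * (inner ℝ x.1 v.1 + inner ℝ x.2 v.2)) ∂(volume.prod volume)

theorem integrable_mul_wave {d : ℕ} {H : Phase d × Phase d → ℂ}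
    (hH : Integrable H (volume.prod volume)) (x : Phase d × Phase d) :
    Integrable (fun v : Phase d × Phase d =>
      H v * cis (2 * Real.pi * (inner ℝ x.1 v.1 + inner ℝ x.2 v.2))) (volume.prod volume) := by
  refine hH.mul_bdd (c := 1) (Continuous.aestronglyMeasurable ?_)
    (Filter.Eventually.of_forall fun v => (norm_cis _).le)
  fun_prop

theorem IsSuperposition.add {d : ℕ} {G₁ G₂ : 𝓢(Phase d × Phase d, ℂ)}
    {H₁ H₂ : Phase d × Phase d → ℂ} (h₁ : IsSuperposition G₁ H₁) (h₂ : IsSuperposition G₂ H₂) :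
    IsSuperposition (G₁ + G₂) (fun v => H₁ v + H₂ v) := by
  refine ⟨h₁.1.add h₂.1, fun x => ?_⟩
  rw [add_apply, h₁.2, h₂.2,
    ← integral_add (integrable_mul_wave h₁.1 x) (integrable_mul_wave h₂.1 x)]
  simp only [add_mul]

theorem IsSuperposition.smul {d : ℕ} {G : 𝓢(Phase d × Phase d, ℂ)}
    {H : Phase d × Phase d → ℂ} (h : IsSuperposition G H) (r : ℂ) :
    IsSuperposition (r • G) (fun v => r * H v) := by
  refine ⟨h.1.const_mul r, fun x => ?_⟩
  rw [smul_apply, h.2, smul_eq_mul, ← integral_const_mul]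
  simp only [mul_assoc]

theorem IsSuperposition.sum {d : ℕ} {ι : Type*} (s : Finset ι) {G : ι → 𝓢(Phase d × Phase d, ℂ)}
    {H : ι → Phase d × Phase d → ℂ} (h : ∀ i ∈ s, IsSuperposition (G i) (H i)) :
    IsSuperposition (∑ i ∈ s, G i) (fun v => ∑ i ∈ s, H i v) := by
  classical
  induction s using Finset.induction_on with
  | empty => exact ⟨by simp, fun x => by simp⟩
  | insert a s ha ih =>
    simp only [Finset.sum_insert ha]
    exact (h a (Finset.mem_insert_self _ _)).add
      (ih fun i hi => h i (Finset.mem_insert_of_mem hi))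

theorem isSuperposition_tensor {d : ℕ} (a b : 𝓢(Phase d, ℂ)) :
    IsSuperposition (tensor a b)
      (fun v => FourierTransform.fourier a v.1 * FourierTransform.fourier b v.2) := by
  refine ⟨((FourierTransform.fourier a).integrable).mul_prod
    ((FourierTransform.fourier b).integrable), fun x => ?_⟩
  change a x.1 * b x.2 = _
  rw [schwartz_rep a, schwartz_rep b, ← integral_prod_mul]
  congr 1
  funext v
  rw [mul_add, cis_add]
  ring

/-- Derivatives send tensors to tensors, so only Fourier transforms on a single phase space are
needed. -/
theorem dz_tensor {d : ℕ} (u : Phase d) (a b : 𝓢(Phase d, ℂ)) :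
    dz u (tensor a b) = tensor (∂_{u} a) b := by
  ext x
  change (∂_{((u, 0) : Phase d × Phase d)} (tensor a b)) x = (∂_{u} a) x.1 * b x.2
  rw [SchwartzMap.lineDerivOp_apply, SchwartzMap.lineDerivOp_apply, lineDeriv, lineDeriv,
    ← deriv_mul_const_field]
  congr 1
  funext t
  change a (x.1 + t • u) * b (x.2 + t • 0) = _
  rw [smul_zero, add_zero]

theorem dw_tensor {d : ℕ} (u : Phase d) (a b : 𝓢(Phase d, ℂ)) :
    dw u (tensor a b) = tensor a (∂_{u} b) := by
  ext x
  change (∂_{((0, u) : Phase d × Phase d)} (tensor a b)) x = a x.1 * (∂_{u} b) x.2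
  rw [SchwartzMap.lineDerivOp_apply, SchwartzMap.lineDerivOp_apply, lineDeriv, lineDeriv,
    ← deriv_const_mul_field]
  congr 1
  funext t
  change a (x.1 + t • 0) * b (x.2 + t • u) = _
  rw [smul_zero, add_zero]

theorem fourier_lineDeriv_apply {d : ℕ} (u : Phase d) (a : 𝓢(Phase d, ℂ)) (ζ : Phase d) :
    (FourierTransform.fourier (∂_{u} a : 𝓢(Phase d, ℂ)) : 𝓢(Phase d, ℂ)) ζ =
      2 * Real.pi * Complex.I * (inner ℝ ζ u : ℝ) * FourierTransform.fourier a ζ := by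
  rw [SchwartzMap.fourier_lineDerivOp_eq, smul_apply,
    SchwartzMap.smulLeftCLM_apply_apply (by fun_prop)]
  simp only [smul_eq_mul, Complex.real_smul]
  ring

theorem inner_dirQ {d : ℕ} (ζ : Phase d) (j : Fin d) : inner ℝ ζ (dirQ j) = ζ.ofLp.1 j := by
  rw [dirQ, WithLp.prod_inner_apply]
  simp [EuclideanSpace.inner_single_right]

theorem inner_dirP {d : ℕ} (ζ : Phase d) (j : Fin d) : inner ℝ ζ (dirP j) = ζ.ofLp.2 j := by
  rw [dirP, WithLp.prod_inner_apply]
  simp [EuclideanSpace.inner_single_right]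

theorem waveSymbol_eq_sum {d : ℕ} (v : Phase d × Phase d) :
    waveSymbol v =
      ∑ j : Fin d, (-(4 * (Real.pi : ℂ) ^ 2) *
        ((v.1.ofLp.1 j * v.2.ofLp.1 j : ℂ) + v.1.ofLp.2 j * v.2.ofLp.2 j)) +
      Complex.I * ∑ j : Fin d, (-(4 * (Real.pi : ℂ) ^ 2) *
        ((v.1.ofLp.2 j * v.2.ofLp.1 j : ℂ) - v.1.ofLp.1 j * v.2.ofLp.2 j)) := by
  have hi : ∀ x y : Config d, inner ℝ x y = ∑ j, x j * y j := fun x y => by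
    rw [PiLp.inner_apply]
    exact Finset.sum_congr rfl fun j _ => mul_comm _ _
  rw [waveSymbol, sympl, WithLp.prod_inner_apply, hi, hi, hi, hi, ← Finset.mul_sum,
    ← Finset.mul_sum, Finset.sum_add_distrib, Finset.sum_sub_distrib]
  push_cast
  ring

/-- One application of the operator gives a combination of tensors of derivatives, to which the
induction hypothesis applies since `a` and `b` are generalized. Each pair of derivatives contributes
`(2πi)²` times a product of frequency coordinates; these add up to one more factor `waveSymbol`. -/
theorem isSuperposition_pow {d : ℕ} (m : ℕ) (a b : 𝓢(Phase d, ℂ)) :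
    IsSuperposition (((gradGrad d + Complex.I • symplGrad d) ^ m) (tensor a b))
      (fun v => FourierTransform.fourier a v.1 * FourierTransform.fourier b v.2 *
        waveSymbol v ^ m) := by
  induction m generalizing a b with
  | zero => simpa using isSuperposition_tensor a b
  | succ m ih =>
    set D := gradGrad d + Complex.I • symplGrad d with hD
    have e : D (tensor a b) =
        ∑ j : Fin d, (tensor (∂_{dirQ j} a) (∂_{dirQ j} b) +
          tensor (∂_{dirP j} a) (∂_{dirP j} b)) +
        Complex.I • ∑ j : Fin d, (tensor (∂_{dirP j} a) (∂_{dirQ j} b) +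
          (-1 : ℂ) • tensor (∂_{dirQ j} a) (∂_{dirP j} b)) := by
      rw [hD, gradGrad, symplGrad]
      simp only [add_apply, smul_apply, sum_apply, sub_apply, ContinuousLinearMap.comp_apply,
        dz_tensor, dw_tensor]
      simp only [neg_one_smul, sub_eq_add_neg]
    rw [pow_succ, mul_apply_eq_comp, e]
    simp only [map_add, map_sum, map_smul]
    have key := (IsSuperposition.sum Finset.univ fun (j : Fin d) _ =>
      (ih (∂_{dirQ j} a) (∂_{dirQ j} b)).add (ih (∂_{dirP j} a) (∂_{dirP j} b))).add
      ((IsSuperposition.sum Finset.univ fun (j : Fin d) _ =>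
        (ih (∂_{dirP j} a) (∂_{dirQ j} b)).add
          ((ih (∂_{dirQ j} a) (∂_{dirP j} b)).smul (-1))).smul Complex.I)
    convert key using 1
    funext v
    simp only [fourier_lineDeriv_apply, inner_dirQ, inner_dirP]
    rw [pow_succ]
    generalize waveSymbol v ^ m = W
    rw [← mul_assoc, waveSymbol_eq_sum, mul_add, mul_left_comm _ Complex.I, Finset.mul_sum,
      Finset.mul_sum]
    have hI : Complex.I ^ 2 = -1 := Complex.I_sq
    congr 1
    · refine Finset.sum_congr rfl fun j _ => ?_
      linear_combination (-4 * (Real.pi : ℂ) ^ 2 * FourierTransform.fourier a v.1 *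
        FourierTransform.fourier b v.2 * W *
        ((v.1.ofLp.1 j * v.2.ofLp.1 j : ℂ) + v.1.ofLp.2 j * v.2.ofLp.2 j)) * hI
    · congr 1
      refine Finset.sum_congr rfl fun j _ => ?_
      linear_combination (-4 * (Real.pi : ℂ) ^ 2 * FourierTransform.fourier a v.1 *
        FourierTransform.fourier b v.2 * W *
        ((v.1.ofLp.2 j * v.2.ofLp.1 j : ℂ) - v.1.ofLp.1 j * v.2.ofLp.2 j)) * hI

/-! ### The expansion and its remainder. -/

theorem fourier_gaussConv {d : ℕ} {ε : ℝ} (hε : 0 < ε) (a : 𝓢(Phase d, ℂ)) (ζ : Phase d) :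
    FourierTransform.fourier (gaussConv ε hε a) ζ =
      FourierTransform.fourier a ζ * (Real.exp (-(Real.pi ^ 2 * ε * ‖ζ‖ ^ 2)) : ℝ) := by
  have hg : FourierTransform.fourier (toComplex (gaussian d ε hε)) ζ =
      (Real.exp (-(Real.pi ^ 2 * ε * ‖ζ‖ ^ 2)) : ℝ) := by
    have h := integral_cis_gaussian hε 0 (-ζ)
    rw [inner_zero_left, norm_neg] at h
    rw [SchwartzMap.fourier_coe, fourier_eq_cis]
    refine Eq.trans ?_ (h.trans ?_)
    · congr 1
      funext u
      rw [inner_neg_right, zero_sub, norm_neg, mul_neg]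
      rfl
    · simp [cis]
  rw [gaussConv, SchwartzMap.fourier_convolution, SchwartzMap.pairing_apply_apply, hg]
  rfl

/-- The symbol `ab + ∑ ε^m λ_m(a,b)` as a superposition of waves. -/
theorem symbol_sum_rep {d : ℕ} (n : ℕ) (ε : ℝ) (a b : 𝓢(Phase d, ℂ)) :
    Integrable (fun v : Phase d × Phase d => FourierTransform.fourier a v.1 *
      FourierTransform.fourier b v.2 * ∑ m ∈ Finset.range (n + 1),
        (-(ε / 2 : ℂ) * waveSymbol v) ^ m / (m.factorial : ℂ)) (volume.prod volume) ∧
    ∀ z, (mulS a b + ∑ m ∈ Finset.Icc 1 n, ((ε : ℂ) ^ m) • lam m a b) z =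
      ∫ v : Phase d × Phase d, (FourierTransform.fourier a v.1 *
        FourierTransform.fourier b v.2 * ∑ m ∈ Finset.range (n + 1),
          (-(ε / 2 : ℂ) * waveSymbol v) ^ m / (m.factorial : ℂ)) *
        cis (2 * Real.pi * inner ℝ z (v.1 + v.2)) ∂(volume.prod volume) := by
  set D := gradGrad d + Complex.I • symplGrad d with hD
  have key := IsSuperposition.sum (Finset.range (n + 1)) fun m _ =>
    (isSuperposition_pow m a b).smul ((ε : ℂ) ^ m * ((-1 : ℂ) ^ m / ((2 : ℂ) ^ m * m.factorial)))
  have e1 : (fun v : Phase d × Phase d => FourierTransform.fourier a v.1 *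
      FourierTransform.fourier b v.2 * ∑ m ∈ Finset.range (n + 1),
        (-(ε / 2 : ℂ) * waveSymbol v) ^ m / (m.factorial : ℂ)) = fun v =>
      ∑ m ∈ Finset.range (n + 1), (ε : ℂ) ^ m * ((-1 : ℂ) ^ m / ((2 : ℂ) ^ m * m.factorial)) *
        (FourierTransform.fourier a v.1 * FourierTransform.fourier b v.2 * waveSymbol v ^ m) := by
    funext v
    rw [Finset.mul_sum]
    refine Finset.sum_congr rfl fun m _ => ?_
    rw [mul_pow, neg_pow, div_pow]
    ring
  have e2 : mulS a b + ∑ m ∈ Finset.Icc 1 n, ((ε : ℂ) ^ m) • lam m a b =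
      diag (∑ m ∈ Finset.range (n + 1),
        ((ε : ℂ) ^ m * ((-1 : ℂ) ^ m / ((2 : ℂ) ^ m * m.factorial))) • (D ^ m) (tensor a b)) := by
    have h0 : mulS a b = diag (tensor a b) := rfl
    -- The term `m = 0`, with coefficient 1, is the product `ab`; the others are shifted to the
    -- range from 1 to `n`.
    rw [Finset.sum_range_succ', map_add, add_comm, map_sum, h0]
    congr 1
    · have : Finset.Icc 1 n = (Finset.range n).map (addRightEmbedding 1) := by
        ext m
        simp only [Finset.mem_Icc, Finset.mem_map, Finset.mem_range, addRightEmbedding_apply]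
        exact ⟨fun h => ⟨m - 1, by omega, by omega⟩, by rintro ⟨k, hk, rfl⟩; omega⟩
      rw [this, Finset.sum_map]
      refine Finset.sum_congr rfl fun m _ => ?_
      rw [addRightEmbedding_apply, lam, smul_smul, map_smul]
    · simp
  refine ⟨e1 ▸ key.1, fun z => ?_⟩
  rw [e2, diag_apply, key.2]
  simp only [inner_add_right]
  congr 1
  funext v
  exact congrArg (· * _) (congrFun e1 v).symm

/-- The identity behind the expansion: `|ζ|² + |ω|² = |ζ+ω|² - 2ζ·ω`, and the cross term joins the
symplectic phase to form `2π²ε(ζ·ω + iσ(ζ,ω))`. -/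
theorem twisted_gaussian_eq {d : ℕ} (ε : ℝ) (v : Phase d × Phase d) :
    (Real.exp (-(Real.pi ^ 2 * ε * ‖v.1‖ ^ 2)) : ℂ) *
      (Real.exp (-(Real.pi ^ 2 * ε * ‖v.2‖ ^ 2)) : ℂ) *
      cis (2 * Real.pi ^ 2 * ε * sympl v.1 v.2) =
    (Real.exp (-(Real.pi ^ 2 * ε * ‖v.1 + v.2‖ ^ 2)) : ℂ) *
      Complex.exp (-(ε / 2 : ℂ) * waveSymbol v) := by
  rw [norm_add_sq_real, cis, waveSymbol, Complex.ofReal_exp, Complex.ofReal_exp,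
    Complex.ofReal_exp, ← Complex.exp_add, ← Complex.exp_add, ← Complex.exp_add]
  congr 1
  push_cast
  ring

/-- The Gaussian tames both entries of the maximum in the Taylor bound: alone it is at most 1, and
times `e^{2π²ε ζ·ω}` it equals `e^{-π²ε(|ζ|²+|ω|²)}`. The bound therefore has no constant depending
on ε. -/
theorem norm_remainder_weight_le {d : ℕ} {ε : ℝ} (hε : 0 < ε) (k : ℕ) (v : Phase d × Phase d) :
    ‖(Real.exp (-(Real.pi ^ 2 * ε * ‖v.1 + v.2‖ ^ 2)) : ℂ) *
      (Complex.exp (-(ε / 2 : ℂ) * waveSymbol v) - ∑ m ∈ Finset.range k,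
        (-(ε / 2 : ℂ) * waveSymbol v) ^ m / (m.factorial : ℂ))‖ ≤ ε ^ k * ‖waveSymbol v‖ ^ k := by
  have hre : (-(ε / 2 : ℂ) * waveSymbol v).re = 2 * Real.pi ^ 2 * ε * inner ℝ v.1 v.2 := by
    have : -(ε / 2 : ℂ) * waveSymbol v =
        ((2 * Real.pi ^ 2 * ε * inner ℝ v.1 v.2 : ℝ) : ℂ) +
        ((2 * Real.pi ^ 2 * ε * sympl v.1 v.2 : ℝ) : ℂ) * Complex.I := by
      rw [waveSymbol]
      push_cast
      ring
    rw [this, Complex.add_re, Complex.ofReal_re, Complex.re_ofReal_mul, Complex.I_re, mul_zero,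
      add_zero]
  have hw : ‖-(ε / 2 : ℂ) * waveSymbol v‖ ≤ ε * ‖waveSymbol v‖ := by
    rw [norm_mul, norm_neg, norm_div, Complex.norm_real, Real.norm_of_nonneg hε.le,
      Complex.norm_ofNat]
    -- The factor `1/2` is simply discarded.
    exact mul_le_mul_of_nonneg_right (by linarith) (norm_nonneg _)
  have hg : Real.exp (-(Real.pi ^ 2 * ε * ‖v.1 + v.2‖ ^ 2)) *
      max 1 (Real.exp (2 * Real.pi ^ 2 * ε * inner ℝ v.1 v.2)) ≤ 1 := by
    have hp : 0 < Real.pi ^ 2 * ε := by positivity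
    rw [mul_max_of_nonneg _ _ (Real.exp_pos _).le, mul_one, ← Real.exp_add]
    refine max_le (Real.exp_le_one_iff.2 ?_) (Real.exp_le_one_iff.2 ?_)
    · exact neg_nonpos.2 (by positivity)
    · rw [norm_add_sq_real]
      have : 0 ≤ Real.pi ^ 2 * ε * (‖v.1‖ ^ 2 + ‖v.2‖ ^ 2) := by positivity
      linarith
  rw [norm_mul, Complex.norm_real, Real.norm_of_nonneg (Real.exp_pos _).le]
  have hT := norm_exp_sub_sum_le_max k (-(ε / 2 : ℂ) * waveSymbol v)
  rw [hre] at hT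
  calc _ ≤ Real.exp (-(Real.pi ^ 2 * ε * ‖v.1 + v.2‖ ^ 2)) *
        ((ε * ‖waveSymbol v‖) ^ k * max 1 (Real.exp (2 * Real.pi ^ 2 * ε * inner ℝ v.1 v.2))) := by
        refine mul_le_mul_of_nonneg_left (hT.trans ?_) (Real.exp_pos _).le
        gcongr
    _ = (ε * ‖waveSymbol v‖) ^ k * (Real.exp (-(Real.pi ^ 2 * ε * ‖v.1 + v.2‖ ^ 2)) *
        max 1 (Real.exp (2 * Real.pi ^ 2 * ε * inner ℝ v.1 v.2))) := by ring
    _ ≤ (ε * ‖waveSymbol v‖) ^ k * 1 := by gcongr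
    _ = _ := by rw [mul_one, mul_pow]

/-- The bound on the operator norm does not involve ε, which gives the uniformity in the theorem. -/
theorem exists_remainder {d : ℕ} (n : ℕ) (a b : 𝓢(Phase d, ℂ)) {ε : ℝ} (hε : 0 < ε) :
    ∃ γ : 𝓢(Phase d, ℂ),
      ‖opWe ε hε γ‖ ≤ ∫ v : Phase d × Phase d, ‖FourierTransform.fourier a v.1 *
        FourierTransform.fourier b v.2 * waveSymbol v ^ (n + 1)‖ ∂(volume.prod volume) ∧
      opAW ε hε a ∘L opAW ε hε b =
        opAW ε hε (mulS a b + ∑ m ∈ Finset.Icc 1 n, ((ε : ℂ) ^ m) • lam m a b) +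
          ((ε : ℂ) ^ (n + 1)) • opWe ε hε γ := by
  obtain ⟨c, hc⟩ := exists_moyal ε (FourierTransform.fourier (gaussConv ε hε a))
    (FourierTransform.fourier (gaussConv ε hε b))
  have hcint := integrable_twisted ε (FourierTransform.fourier (gaussConv ε hε a))
    (FourierTransform.fourier (gaussConv ε hε b))
  obtain ⟨hSint, hS⟩ := symbol_sum_rep n ε a b
  set S := mulS a b + ∑ m ∈ Finset.Icc 1 n, ((ε : ℂ) ^ m) • lam m a b with hSdef
  have hG := gaussConv_of_rep hε hSint measurable_add_phase hS
  have hε0 : ((ε : ℂ) ^ (n + 1)) ≠ 0 := pow_ne_zero _ (by exact_mod_cast hε.ne')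
  set R : Phase d × Phase d → ℂ := fun v =>
    (Real.exp (-(Real.pi ^ 2 * ε * ‖v.1 + v.2‖ ^ 2)) : ℂ) *
      (Complex.exp (-(ε / 2 : ℂ) * waveSymbol v) - ∑ m ∈ Finset.range (n + 1),
        (-(ε / 2 : ℂ) * waveSymbol v) ^ m / (m.factorial : ℂ)) with hR
  set W : Phase d × Phase d → ℂ := fun v => ((ε : ℂ) ^ (n + 1))⁻¹ *
    (FourierTransform.fourier a v.1 * FourierTransform.fourier b v.2 * R v) with hW
  have hGint : Integrable (fun v : Phase d × Phase d => FourierTransform.fourier a v.1 *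
      FourierTransform.fourier b v.2 * (∑ m ∈ Finset.range (n + 1),
        (-(ε / 2 : ℂ) * waveSymbol v) ^ m / (m.factorial : ℂ)) *
      (Real.exp (-(Real.pi ^ 2 * ε * ‖v.1 + v.2‖ ^ 2)) : ℝ)) (volume.prod volume) := by
    refine hSint.mul_bdd (c := 1) (Continuous.aestronglyMeasurable (by fun_prop))
      (Filter.Eventually.of_forall fun v => ?_)
    rw [Complex.norm_real, Real.norm_of_nonneg (Real.exp_pos _).le, Real.exp_le_one_iff]
    exact neg_nonpos.2 (by positivity)
  have hWeq : ∀ v, W v = ((ε : ℂ) ^ (n + 1))⁻¹ *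
      (FourierTransform.fourier (gaussConv ε hε a) v.1 *
        FourierTransform.fourier (gaussConv ε hε b) v.2 *
        cis (2 * Real.pi ^ 2 * ε * sympl v.1 v.2) - FourierTransform.fourier a v.1 *
      FourierTransform.fourier b v.2 * (∑ m ∈ Finset.range (n + 1),
        (-(ε / 2 : ℂ) * waveSymbol v) ^ m / (m.factorial : ℂ)) *
      (Real.exp (-(Real.pi ^ 2 * ε * ‖v.1 + v.2‖ ^ 2)) : ℝ)) := by
    intro v
    rw [hW, fourier_gaussConv, fourier_gaussConv]
    linear_combination (-((ε : ℂ) ^ (n + 1))⁻¹ * FourierTransform.fourier a v.1 *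
      FourierTransform.fourier b v.2) * twisted_gaussian_eq ε v
  have hWint : Integrable W (volume.prod volume) := by
    rw [funext hWeq]
    exact (hcint.sub hGint).const_mul _
  -- The operator identity forces this choice: Moyal product minus smoothed expansion, rescaled.
  -- What needs proof is that its weight is `W`, to which the Taylor bound applies.
  set γ := ((ε : ℂ) ^ (n + 1))⁻¹ • (c - gaussConv ε hε S) with hγ
  have hγrep : ∀ z, γ z = ∫ v : Phase d × Phase d, W v *
      cis (2 * Real.pi * inner ℝ z (v.1 + v.2)) ∂(volume.prod volume) := by
    intro z
    have hb : ∀ {H : Phase d × Phase d → ℂ}, Integrable H (volume.prod volume) →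
        Integrable (fun v : Phase d × Phase d => H v *
          cis (2 * Real.pi * inner ℝ z (v.1 + v.2))) (volume.prod volume) := fun h =>
      h.mul_bdd (c := 1) (Continuous.aestronglyMeasurable (by fun_prop))
        (Filter.Eventually.of_forall fun v => (norm_cis _).le)
    change ((ε : ℂ) ^ (n + 1))⁻¹ * (c z - gaussConv ε hε S z) = _
    rw [hc, hG, ← integral_sub (hb hcint) (hb hGint), ← integral_const_mul]
    congr 1
    funext v
    rw [hWeq]
    ring
  refine ⟨γ, (norm_opWe_le hε hWint measurable_add_phase hγrep).trans ?_, ?_⟩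
  · refine integral_mono hWint.norm (isSuperposition_pow (n + 1) a b).1.norm fun v => ?_
    have := norm_remainder_weight_le hε (n + 1) v
    simp only [hW]
    rw [norm_mul, norm_mul, norm_inv, norm_pow, Complex.norm_real, Real.norm_of_nonneg hε.le,
      norm_mul _ (waveSymbol v ^ (n + 1)), norm_pow, inv_mul_le_iff₀ (by positivity),
      mul_left_comm]
    exact mul_le_mul_of_nonneg_left this (norm_nonneg _)
  · rw [opAW, opAW, opAW, opWe_comp hε hc, ← opWe_add_smul hε, hγ, smul_smul,
      mul_inv_cancel₀ hε0, one_smul, add_sub_cancel]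

end AntiWick

end

theorem mainTheorem9 (d n : ℕ)
    (a b : 𝓢(AntiWick.Phase d, ℝ)) :
    ∃ γ : ℝ → 𝓢(AntiWick.Phase d, ℂ),
      (∃ C : ℝ, ∀ (ε : ℝ) (hε : 0 < ε), ‖AntiWick.opWe ε hε (γ ε)‖ ≤ C) ∧
      ∀ (ε : ℝ) (hε : 0 < ε),
        AntiWick.opAW ε hε (AntiWick.toComplex a) ∘L AntiWick.opAW ε hε (AntiWick.toComplex b) =
          AntiWick.opAW ε hε
            (AntiWick.mulS (AntiWick.toComplex a) (AntiWick.toComplex b) +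
              ∑ m ∈ Finset.Icc 1 n,
                ((ε : ℂ) ^ m) • AntiWick.lam m (AntiWick.toComplex a) (AntiWick.toComplex b)) +
          ((ε : ℂ) ^ (n + 1)) • AntiWick.opWe ε hε (γ ε) := by
  choose γ hγ using fun (ε : ℝ) (hε : 0 < ε) =>
    AntiWick.exists_remainder n (AntiWick.toComplex a) (AntiWick.toComplex b) hε
  -- The value 0 for nonpositive ε is a mere default. The constant left open is the ε-free integral
  -- from `exists_remainder`.
  refine ⟨fun ε => if hε : 0 < ε then γ ε hε else 0,
    ⟨_, fun ε hε => le_of_eq_of_le ?_ (hγ ε hε).1⟩, fun ε hε => ?_⟩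
  · simp only [dif_pos hε]
  · simp only [dif_pos hε]
    exact (hγ ε hε).2
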